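/- For a finite group $G$, let $F(G)$ denote its Fitting subgroup, $Z(G)$ its center, and $C_G(M)$ the centralizer in $G$ of a subgroup $M$. A $q$-group ($q$ prime) is extraspecial if it is finite, its center has order $q$, and its quotient by the center is a nontrivial elementary abelian $q$-group. A subgroup of $\mathrm{GL}(n,\mathbb{C})$ is primitive if it acts irreducibly on $\mathbb{C}^n$ and does not permute the summands of any decomposition of $\mathbb{C}^n$ as a direct sum of at least two nonzero subspaces. (a) Let $G$ be a primitive permutation group of prime power degree $d=q^m$ ($q$ prime) with $F(G)\neq 1$. Then $F(G)$ is the unique largest abelian normal subgroup of $G$ (it is abelian and normal, and contains every abelian normal subgroup of $G$). Furthermore, $$|G|\le 24^{\frac{d-1}{3}}<3^{d-1}\qquad\text{and}\qquad [G:F(G)]\le 168^{\frac{d-1}{7}}.$$ (b) Let $G$ be a finite primitive subgroup of $\mathrm{GL}(n,\mathbb{C})$ with $F(G)\neq Z(G)$, and let $M$ be a normal subgroup of $G$ with $Z(G)<M\le F(G)$, minimal subject to that. Then there are a prime $q$ and an integer $m\ge 1$ such that $q^m$ divides $n$, $M=Z(G)Q$ for some extraspecial $q$-subgroup $Q$ of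 $G$ of order $q^{2m+1}$, and $$[G:MC_G(M)]\le 720^{\frac{q^m-1}{3}}<9^{q^m-1},\qquad [G:C_G(M)]\le 24^{q^m-1}.$$ -/

import Mathlib

/-- The Fitting subgroup of `G`: the subgroup generated by all nilpotent normal subgroups of `G`.
If `G` is finite, this is the largest nilpotent normal subgroup of `G`. -/
def fittingSubgroup (G : Type*) [Group G] : Subgroup G :=
  sSup {N : Subgroup G | N.Normal ∧ Group.IsNilpotent N}

/-- `Q` is an extraspecial `p`-group: a finite `p`-group whose center `Z` has order `p` and such
that `Q / Z` is a nontrivial elementary abelian `p`-group. -/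
structure IsExtraspecial (p : ℕ) (Q : Type*) [Group Q] : Prop where
  finite : Finite Q
  isPGroup : IsPGroup p Q
  card_center : Nat.card (Subgroup.center Q) = p
  nontrivial_quotient : Nontrivial (Q ⧸ Subgroup.center Q)
  comm_quotient : ∀ a b : Q ⧸ Subgroup.center Q, a * b = b * a
  pow_quotient : ∀ a : Q ⧸ Subgroup.center Q, a ^ p = 1

/-- The natural representation on `ℂⁿ` (by multiplication of column vectors) of a subgroup of
`GL(n, ℂ)`. -/
noncomputable def naturalRep {n : ℕ} (G : Subgroup (Matrix.GeneralLinearGroup (Fin n) ℂ)) :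
    Representation ℂ G (Fin n → ℂ) :=
  (Units.coeHom _).comp (Matrix.GeneralLinearGroup.toLin.toMonoidHom.comp G.subtype)

/-- A subgroup `G` of `GL(n, ℂ)` is primitive (as a linear group) if it acts irreducibly on `ℂⁿ`
and there is no decomposition of `ℂⁿ` as a direct sum of at least two nonzero subspaces which are
permuted by `G`. -/
structure IsPrimitiveLinearGroup {n : ℕ} (G : Subgroup (Matrix.GeneralLinearGroup (Fin n) ℂ)) :
    Prop where
  irreducible : (naturalRep G).IsIrreducible
  no_imprimitivity : ∀ (k : ℕ) (V : Fin k → Submodule ℂ (Fin n → ℂ)),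
    DirectSum.IsInternal V → (∀ i, V i ≠ ⊥) →
    (∀ (g : G) (i : Fin k), ∃ j : Fin k, (V i).map (naturalRep G g) = V j) → k ≤ 1

/-! Part (a). A nilpotent normal subgroup `N ≠ 1` of a primitive permutation group contains the
abelian normal subgroup `Z(N) ≠ 1`, which is transitive, hence regular and its own centralizer; so
`N = Z(N)`. Two different such subgroups would intersect trivially and therefore centralize each
other, so there is only one, and it is `F(G)` (`fittingSubgroup_of_isPreprimitive`). Hence
`G / F(G)` embeds in the automorphism group of a group of order `q ^ m`, which has at most
`|GL(m, q)|` elements (`card_mulAut_le`): an automorphism is counted by the images of a chain of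
generators.

Part (b). The common eigenspaces of an abelian normal subgroup of `G` are permuted by `G`, so
primitivity makes every such subgroup scalar and hence central
(`IsPrimitiveLinearGroup.le_center`). A nilpotent normal subgroup acts trivially on the chief
factor `M / Z(G)`, so `M` has class two, its center is `Z(G)`, and by minimality `M / Z(G)` is an
elementary abelian `q`-group. On it the commutator is a nondegenerate alternating form with values
in the subgroup of order `q` of the cyclic group `Z(G)`. Splitting off hyperbolic pairs one after
the other gives `|M / Z(G)| = q ^ (2 m)` and bounds the number of automorphisms of `M` that fix
`Z(G)` pointwise by `q ^ (2 m) |Sp(2 m, q)|`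
(`exists_index_center_card_fixingSubgroup_le`). This bounds `[G : C_G(M)]`, and dividing by
`[M C_G(M) : C_G(M)] = q ^ (2 m)` bounds `[G : M C_G(M)]`. The argument is carried out inside `M`
by orbit-stabilizer on noncommuting pairs, so that no symplectic space has to be formed.

The extraspecial group `Q` is found among the elements of order dividing `q ^ 2`
(`exists_isExtraspecial_sup_eq_top`). The character `χ` of `M` on `ℂⁿ` vanishes off `Z(G)`, so that
`n ^ 2 / q ^ (2 m) = ⟨χ, χ⟩` is an integer, and `q ^ m ∣ n`
(`IsPrimitiveLinearGroup.card_dvd`).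

The numerical estimates compare `|GL(m, q)|` and `|Sp(2 m, q)|` with exponentials by induction on
`m`. Equality occurs for `q ^ m = 4` and `q ^ m = 8` in (a), and for `q ^ m = 4` and `q ^ m = 2`
in (b), so small `m` are treated numerically when `q = 2`. -/

/-! ### Groups in which all commutators are central -/

section ClassTwo

open Subgroup
open scoped commutatorElement

variable {P : Type*} [Group P]

/-- In a group whose commutators are all central, `x ↦ ⁅x, y⁆` is a homomorphism to the center. -/
def commutatorLeftHom (hc : ∀ x y : P, ⁅x, y⁆ ∈ center P) (y : P) : P →* center P where
  toFun x := ⟨⁅x, y⁆, hc x y⟩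
  map_one' := by simp
  map_mul' a b := by
    ext
    have h := mem_center_iff.1 (hc b y) a
    simp only [commutatorElement_mul_left_eq_conj_mul, coe_mul, h, mul_inv_cancel_right]
    exact mem_center_iff.1 (hc a y) _

@[simp] theorem coe_commutatorLeftHom (hc : ∀ x y : P, ⁅x, y⁆ ∈ center P) (x y : P) :
    (commutatorLeftHom hc y x : P) = ⁅x, y⁆ := rfl

theorem commutator_mul_left (hc : ∀ x y : P, ⁅x, y⁆ ∈ center P) (a b y : P) :
    ⁅a * b, y⁆ = ⁅a, y⁆ * ⁅b, y⁆ :=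
  congrArg Subtype.val ((commutatorLeftHom hc y).map_mul a b)

theorem commutator_pow_left (hc : ∀ x y : P, ⁅x, y⁆ ∈ center P) (a y : P) (n : ℕ) :
    ⁅a ^ n, y⁆ = ⁅a, y⁆ ^ n :=
  congrArg Subtype.val ((commutatorLeftHom hc y).map_pow a n)

theorem commutator_zpow_left (hc : ∀ x y : P, ⁅x, y⁆ ∈ center P) (a y : P) (n : ℤ) :
    ⁅a ^ n, y⁆ = ⁅a, y⁆ ^ n :=
  congrArg Subtype.val ((commutatorLeftHom hc y).map_zpow a n)

theorem commutator_eq_one_of_mem_center_left {z : P} (hz : z ∈ center P) (y : P) : ⁅z, y⁆ = 1 :=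
  commutatorElement_eq_one_iff_mul_comm.2 (mem_center_iff.1 hz y).symm

/-- The exponent `k` is `n.choose 2`, but only its existence matters. -/
theorem mul_pow_eq_mul_commutator_pow (hc : ∀ x y : P, ⁅x, y⁆ ∈ center P) (x y : P) (n : ℕ) :
    ∃ k : ℕ, (x * y) ^ n = x ^ n * y ^ n * ⁅y, x⁆ ^ k := by
  induction n with
  | zero => exact ⟨0, by simp⟩
  | succ n ih =>
    obtain ⟨k, hk⟩ := ih
    refine ⟨n + k, ?_⟩
    have h1 : y ^ n * x = ⁅y, x⁆ ^ n * x * y ^ n := by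
      rw [← commutator_pow_left hc, commutatorElement_def]; group
    have h2 : ∀ (j : ℕ) (g : P), g * ⁅y, x⁆ ^ j = ⁅y, x⁆ ^ j * g := fun j g =>
      mem_center_iff.1 (pow_mem (hc y x) j) g
    calc (x * y) ^ (n + 1) = x ^ n * y ^ n * (⁅y, x⁆ ^ k * (x * y)) := by
          rw [pow_succ, hk]; group
      _ = x ^ n * (y ^ n * x) * y * ⁅y, x⁆ ^ k := by rw [← h2]; group
      _ = x ^ n * (⁅y, x⁆ ^ n * (x * y ^ n)) * y * ⁅y, x⁆ ^ k := by rw [h1]; group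
      _ = x ^ n * (x * y ^ n * ⁅y, x⁆ ^ n) * y * ⁅y, x⁆ ^ k := by rw [← h2]
      _ = x ^ (n + 1) * y ^ n * (⁅y, x⁆ ^ n * y) * ⁅y, x⁆ ^ k := by group
      _ = x ^ (n + 1) * y ^ (n + 1) * ⁅y, x⁆ ^ (n + k) := by rw [← h2]; group

theorem commutator_pow_eq_one (hc : ∀ x y : P, ⁅x, y⁆ ∈ center P) {q : ℕ} {x : P}
    (hq : x ^ q ∈ center P) (y : P) : ⁅x, y⁆ ^ q = 1 := by
  rw [← commutator_pow_left hc, commutator_eq_one_of_mem_center_left hq]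

theorem mul_pow_mem_center (hc : ∀ x y : P, ⁅x, y⁆ ∈ center P) {q : ℕ} {x y : P}
    (hx : x ^ q ∈ center P) (hy : y ^ q ∈ center P) : (x * y) ^ q ∈ center P := by
  obtain ⟨k, hk⟩ := mul_pow_eq_mul_commutator_pow hc x y q
  rw [hk]
  exact mul_mem (mul_mem hx hy) (pow_mem (hc y x) k)

/-- The map `x ↦ x ^ q ^ 2` is multiplicative also for `q = 2`, when `x ↦ x ^ q` need not be. -/
theorem mul_pow_pow_eq (hc : ∀ x y : P, ⁅x, y⁆ ∈ center P) {q : ℕ}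
    (hq : ∀ x : P, x ^ q ∈ center P) (x y : P) :
    (x * y) ^ q ^ 2 = x ^ q ^ 2 * y ^ q ^ 2 := by
  obtain ⟨k, hk⟩ := mul_pow_eq_mul_commutator_pow hc x y q
  have h1 : Commute (x ^ q) (y ^ q) := (mem_center_iff.1 (hq y) _)
  have h2 : Commute (x ^ q * y ^ q) (⁅y, x⁆ ^ k) := (mem_center_iff.1 (pow_mem (hc y x) k) _)
  rw [pow_two, pow_mul, hk, h2.mul_pow, h1.mul_pow, ← pow_mul, ← pow_mul, ← pow_mul ⁅y, x⁆,
    mul_comm k, pow_mul ⁅y, x⁆, commutator_pow_eq_one hc (hq y), one_pow, mul_one]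

variable [Finite P] [IsCyclic (center P)]

theorem ncard_center_pow_eq_one_le {q : ℕ} (hq : 0 < q) :
    {z : P | z ∈ center P ∧ z ^ q = 1}.ncard ≤ q := by
  classical
  have := Fintype.ofFinite P
  have h := IsCyclic.card_pow_eq_one_le (α := center P) hq
  refine le_trans (le_of_eq ?_) h
  rw [← Finset.card_map (Function.Embedding.subtype _), ← Set.ncard_coe_finset]
  congr 1
  ext z
  simp only [Set.mem_ofPred_eq, Finset.coe_map, Function.Embedding.subtype_apply,
    Finset.coe_filter, Finset.mem_univ, true_and, Set.mem_image, Subtype.exists]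
  constructor
  · rintro ⟨h, h'⟩; exact ⟨z, h, by ext; simpa using h', rfl⟩
  · rintro ⟨a, h, h', rfl⟩; exact ⟨h, by simpa using congrArg Subtype.val h'⟩

/-- In a cyclic center, an element of prime order `q` generates all elements of order dividing
`q`. -/
theorem mem_zpowers_of_pow_eq_one {q : ℕ} (hq : q.Prime) {c z : P} (hcz : c ∈ center P)
    (hcq : c ^ q = 1) (hc1 : c ≠ 1) (hz : z ∈ center P) (hzq : z ^ q = 1) : z ∈ zpowers c := by
  have := Fact.mk hq
  have hsub : (zpowers c : Set P) ⊆ {z : P | z ∈ center P ∧ z ^ q = 1} := by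
    rintro _ ⟨i, rfl⟩
    exact ⟨zpow_mem hcz i, by
      simp only [← zpow_natCast, ← zpow_mul]; rw [mul_comm, zpow_mul, zpow_natCast, hcq, one_zpow]⟩
  have hcard : (zpowers c : Set P).ncard = q := by
    rw [← Nat.card_coe_set_eq]
    exact (Nat.card_zpowers c).trans (orderOf_eq_prime hcq hc1)
  have heq := Set.eq_of_subset_of_ncard_le hsub
    (hcard.symm ▸ ncard_center_pow_eq_one_le hq.pos) (Set.toFinite _)
  have hmem : z ∈ {z : P | z ∈ center P ∧ z ^ q = 1} := ⟨hz, hzq⟩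
  rwa [← heq] at hmem

/-- A coset of the center contains at most `q` elements with a given `q`-th power. -/
theorem ncard_pow_eq_le {q : ℕ} (hq : 0 < q) (t : P) (S : Set P) (hS : ∀ b ∈ S, b ^ q = t) :
    S.ncard ≤ q * ((QuotientGroup.mk : P → P ⧸ center P) '' S).ncard := by
  classical
  have := Fintype.ofFinite P
  have h := Finset.card_le_mul_card_image (f := (QuotientGroup.mk : P → P ⧸ center P)) S.toFinset q
    (fun a ha => ?_)
  · rw [Set.ncard_eq_toFinset_card', Set.ncard_eq_toFinset_card']
    simpa [Set.toFinset_image] using h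
  · obtain ⟨b, hb, rfl⟩ := Finset.mem_image.1 ha
    rw [← Set.ncard_coe_finset]
    refine le_trans (Set.ncard_le_ncard_of_injOn (fun x => b⁻¹ * x) ?_ ?_)
      (ncard_center_pow_eq_one_le (P := P) hq)
    · intro x hx
      simp only [Finset.coe_filter, Set.mem_toFinset, Set.mem_ofPred_eq] at hx hb ⊢
      have hz : b⁻¹ * x ∈ center P := QuotientGroup.eq.1 hx.2.symm
      refine ⟨hz, ?_⟩
      have hx' : (b * (b⁻¹ * x)) ^ q = t := by simpa using hS x hx.1
      have hcomm : Commute b (b⁻¹ * x) := mem_center_iff.1 hz b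
      rw [hcomm.mul_pow, hS b hb] at hx'
      simpa using hx'
    · exact fun x _ y _ h => mul_left_cancel h

end ClassTwo

/-! ### Counting automorphisms that fix the center -/

section ClassTwoCount

open Subgroup
open scoped commutatorElement

universe u

/-- The order `∏ (q ^ (2 i) - 1) q ^ (2 i - 1)` (over `1 ≤ i ≤ m`) of the symplectic group
`Sp(2 m, q)`. -/
def symplecticCard (q m : ℕ) : ℕ :=
  ∏ i ∈ Finset.range m, (q ^ (2 * (i + 1)) - 1) * q ^ (2 * i + 1)

theorem symplecticCard_succ (q m : ℕ) :
    symplecticCard q (m + 1) =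
      symplecticCard q m * ((q ^ (2 * (m + 1)) - 1) * q ^ (2 * m + 1)) :=
  Finset.prod_range_succ _ _

variable {P : Type u} [Group P]

theorem mem_centralizer_pair {e f x : P} :
    x ∈ centralizer ({e, f} : Set P) ↔ ⁅x, e⁆ = 1 ∧ ⁅x, f⁆ = 1 := by
  simp only [mem_centralizer_iff, Set.mem_insert_iff, Set.mem_singleton_iff, forall_eq_or_imp,
    forall_eq, commutatorElement_eq_one_iff_mul_comm]
  exact and_congr eq_comm eq_comm

variable [Finite P]

/-- In `P / Z(P)`, regarded as a symplectic space, the solutions of `⁅a, b⁆ = c` for fixed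
noncentral `a` lie in a coset of a hyperplane. -/
theorem ncard_image_commutator_eq_le (hc : ∀ x y : P, ⁅x, y⁆ ∈ center P) {q : ℕ}
    (hqp : q.Prime) (hq : ∀ x : P, x ^ q ∈ center P) {k : ℕ} (hk : (center P).index = q ^ (k + 1))
    (a c : P) (hc1 : c ≠ 1) :
    ((QuotientGroup.mk : P → P ⧸ center P) '' {b : P | ⁅b, a⁆ = c}).ncard ≤ q ^ k := by
  have := Fact.mk hqp
  by_cases hb : ∃ b : P, ⁅b, a⁆ = c
  swap
  · push Not at hb
    rw [Set.eq_empty_of_forall_notMem (s := {b : P | ⁅b, a⁆ = c}) (fun b h => hb b h)]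
    simp
  obtain ⟨b₀, hb₀⟩ := hb
  let ψ : P ⧸ center P →* center P := QuotientGroup.lift (center P) (commutatorLeftHom hc a)
    (fun z hz => Subtype.ext (commutator_eq_one_of_mem_center_left hz a))
  have hrange : q ≤ Nat.card ψ.range := by
    have hord : orderOf (⟨c, hb₀ ▸ hc b₀ a⟩ : center P) = q := by
      apply orderOf_eq_prime
      · exact Subtype.ext (by simpa [← hb₀] using commutator_pow_eq_one hc (hq b₀) a)
      · exact fun h => hc1 (congrArg Subtype.val h)
    rw [← hord, ← Nat.card_zpowers]
    refine Nat.card_le_card_of_injective _ (Subgroup.inclusion_injective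
      (zpowers_le.2 (MonoidHom.mem_range.2 ⟨(b₀ : P ⧸ center P), Subtype.ext hb₀⟩)))
  have hker : Nat.card ψ.ker ≤ q ^ k := by
    have h := ψ.ker.card_mul_index
    rw [index_ker, ← Subgroup.index, hk, pow_succ] at h
    exact Nat.le_of_mul_le_mul_right (h ▸ Nat.mul_le_mul_left _ hrange) hqp.pos
  refine le_trans ?_ hker
  rw [← SetLike.coe_sort_coe, Nat.card_coe_set_eq]
  refine Set.ncard_le_ncard_of_injOn (fun x => (b₀ : P ⧸ center P)⁻¹ * x) ?_
    (fun x _ y _ h => mul_left_cancel h)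
  rintro _ ⟨b, hb, rfl⟩
  refine MonoidHom.mem_ker.2 ?_
  rw [map_mul, map_inv, inv_mul_eq_one]
  exact Subtype.ext (hb₀.trans hb.symm)

variable [IsCyclic (center P)]

/-- If `e`, `f` do not commute, then `x ↦ (⁅x, e⁆, ⁅x, f⁆)` already takes all its values on
products of powers of `e` and `f`. -/
theorem exists_mul_mem_centralizer_pair (hc : ∀ x y : P, ⁅x, y⁆ ∈ center P) {q : ℕ}
    (hqp : q.Prime) (hq : ∀ x : P, x ^ q ∈ center P) {e f : P} (hef : ⁅e, f⁆ ≠ 1) (x : P) :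
    ∃ i j : ℤ, f ^ i * e ^ j * x ∈ centralizer ({e, f} : Set P) := by
  have h : ∀ y, ∃ i : ℤ, ⁅e, f⁆ ^ i = ⁅x, y⁆ := fun y =>
    mem_zpowers_iff.1 <| mem_zpowers_of_pow_eq_one hqp (hc e f)
      (commutator_pow_eq_one hc (hq e) f) hef (hc x y) (commutator_pow_eq_one hc (hq x) y)
  obtain ⟨i, hi⟩ := h e
  obtain ⟨j, hj⟩ := h f
  refine ⟨i, -j, mem_centralizer_pair.2 ⟨?_, ?_⟩⟩
  · rw [commutator_mul_left hc, commutator_mul_left hc, commutator_zpow_left hc,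
      commutator_zpow_left hc, commutatorElement_self, ← hi, ← commutatorElement_inv e f, one_zpow, mul_one, inv_zpow,
      inv_mul_cancel]
  · rw [commutator_mul_left hc, commutator_mul_left hc, commutator_zpow_left hc,
      commutator_zpow_left hc, commutatorElement_self, ← hj]
    simp

/-- The centralizer of a noncommuting pair again has center `Z(P)`. -/
theorem map_center_centralizer_pair (hc : ∀ x y : P, ⁅x, y⁆ ∈ center P) {q : ℕ}
    (hqp : q.Prime) (hq : ∀ x : P, x ^ q ∈ center P) {e f : P} (hef : ⁅e, f⁆ ≠ 1) :
    (center (centralizer ({e, f} : Set P))).map (centralizer ({e, f} : Set P)).subtype =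
      center P := by
  ext z
  constructor
  · rintro ⟨⟨z, hz⟩, hz', rfl⟩
    refine mem_center_iff.2 fun x => ?_
    obtain ⟨i, j, hx⟩ := exists_mul_mem_centralizer_pair hc hqp hq hef x
    have h1 : Commute (f ^ i * e ^ j * x) z :=
      congrArg Subtype.val (mem_center_iff.1 hz' ⟨_, hx⟩)
    have hz := mem_centralizer_pair.1 hz
    have h2 : Commute e z := (commutatorElement_eq_one_iff_commute.1 hz.1).symm
    have h3 : Commute f z := (commutatorElement_eq_one_iff_commute.1 hz.2).symm
    have h4 := ((h3.zpow_left i).mul_left (h2.zpow_left j)).inv_left.mul_left h1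
    rw [inv_mul_cancel_left] at h4
    exact h4.eq
  · intro hz
    exact ⟨⟨z, center_le_centralizer _ hz⟩,
      mem_center_iff.2 fun x => Subtype.ext (mem_center_iff.1 hz x), rfl⟩

theorem index_centralizer_pair (hc : ∀ x y : P, ⁅x, y⁆ ∈ center P) {q : ℕ}
    (hqp : q.Prime) (hq : ∀ x : P, x ^ q ∈ center P) {e f : P} (hef : ⁅e, f⁆ ≠ 1) :
    (centralizer ({e, f} : Set P)).index = q ^ 2 := by
  have := Fact.mk hqp
  let φ : P →* center P × center P := (commutatorLeftHom hc e).prod (commutatorLeftHom hc f)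
  have hker : φ.ker = centralizer ({e, f} : Set P) := by
    ext x
    simp [φ, mem_centralizer_pair, Prod.ext_iff, Subtype.ext_iff, MonoidHom.mem_ker]
  let c : center P := ⟨⁅e, f⁆, hc e f⟩
  have hcq : c ^ q = 1 := Subtype.ext (commutator_pow_eq_one hc (hq e) f)
  have hc1 : c ≠ 1 := fun h => hef (congrArg Subtype.val h)
  have hrange : φ.range = (zpowers c).prod (zpowers c) := by
    have key : ∀ x y, (⟨⁅x, y⁆, hc x y⟩ : center P) ∈ zpowers c := fun x y => by
      obtain ⟨i, hi⟩ := mem_zpowers_iff.1 (mem_zpowers_of_pow_eq_one hqp (hc e f)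
        (commutator_pow_eq_one hc (hq e) f) hef (hc x y) (commutator_pow_eq_one hc (hq x) y))
      exact mem_zpowers_iff.2 ⟨i, Subtype.ext hi⟩
    ext ⟨a, b⟩
    rw [mem_prod]
    constructor
    · rintro ⟨x, hx⟩
      rw [← hx]
      exact ⟨key x e, key x f⟩
    · rintro ⟨⟨i, rfl⟩, ⟨j, rfl⟩⟩
      refine ⟨f ^ (-i) * e ^ j, ?_⟩
      ext
      · change ⁅f ^ (-i) * e ^ j, e⁆ = _
        rw [commutator_mul_left hc, commutator_zpow_left hc, commutator_zpow_left hc,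
          commutatorElement_self, ← commutatorElement_inv e f, one_zpow, mul_one, inv_zpow', neg_neg]
        rfl
      · change ⁅f ^ (-i) * e ^ j, f⁆ = _
        rw [commutator_mul_left hc, commutator_zpow_left hc, commutator_zpow_left hc,
          commutatorElement_self]
        simp [c]
  rw [← hker, index_ker, hrange, Nat.card_congr ((zpowers c).prodEquiv _).toEquiv, Nat.card_prod,
    Nat.card_zpowers, orderOf_eq_prime hcq hc1, pow_two]

/-- The number of images of a noncommuting pair `(e, f)` under automorphisms of `P` that fix
`Z(P)`: they have the same commutator and the same `q`-th powers as `(e, f)`. -/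
theorem ncard_orbit_pair_le (hc : ∀ x y : P, ⁅x, y⁆ ∈ center P) {q : ℕ}
    (hqp : q.Prime) (hq : ∀ x : P, x ^ q ∈ center P) {k : ℕ} (hk : (center P).index = q ^ (k + 1))
    {e f : P} (hef : ⁅e, f⁆ ≠ 1) :
    (MulAction.orbit (fixingSubgroup (MulAut P) (center P : Set P)) (e, f)).ncard ≤
      (q * q ^ k) * (q * (q ^ (k + 1) - 1)) := by
  classical
  have := Fintype.ofFinite P
  set S : Set (P × P) :=
    {x | ⁅x.1, x.2⁆ = ⁅e, f⁆ ∧ x.1 ^ q = e ^ q ∧ x.2 ^ q = f ^ q} with hS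
  have hsub : MulAction.orbit (fixingSubgroup (MulAut P) (center P : Set P)) (e, f) ⊆ S := by
    rintro _ ⟨⟨γ, hγ⟩, rfl⟩
    rw [mem_fixingSubgroup_iff] at hγ
    refine ⟨?_, ?_, ?_⟩
    · exact (map_commutatorElement γ e f).symm.trans (hγ _ (hc e f))
    · exact (map_pow γ e q).symm.trans (hγ _ (hq e))
    · exact (map_pow γ f q).symm.trans (hγ _ (hq f))
  have hsub1 : Prod.fst '' S ⊆ {a | a ^ q = e ^ q ∧ a ∉ center P} := by
    rintro _ ⟨⟨a, b⟩, ⟨h1, h2, h3⟩, rfl⟩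
    exact ⟨h2, fun h => hef (h1 ▸ commutator_eq_one_of_mem_center_left h b)⟩
  have hfst : (Prod.fst '' S).ncard ≤ q * (q ^ (k + 1) - 1) := by
    refine (Set.ncard_le_ncard hsub1).trans ((ncard_pow_eq_le hqp.pos (e ^ q) _
      (fun b hb => hb.1)).trans (Nat.mul_le_mul_left _ ?_))
    rw [← hk, Subgroup.index, ← Set.ncard_univ, ← Set.ncard_singleton (1 : P ⧸ center P),
      ← Set.ncard_sdiff (Set.subset_univ _)]
    refine Set.ncard_le_ncard ?_
    rintro _ ⟨a, ⟨-, ha⟩, rfl⟩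
    exact ⟨trivial, fun h => ha ((QuotientGroup.eq_one_iff a).1 h)⟩
  have hsnd : ∀ a ∈ S.toFinset.image Prod.fst,
      (S.toFinset.filter (fun x => x.1 = a)).card ≤ q * q ^ k := by
    intro a _
    have h1 : (S.toFinset.filter (fun x => x.1 = a)).card ≤
        {b | ⁅a, b⁆ = ⁅e, f⁆ ∧ b ^ q = f ^ q}.ncard := by
      rw [← Set.ncard_coe_finset]
      refine Set.ncard_le_ncard_of_injOn Prod.snd ?_ ?_
      · rintro ⟨a', b⟩ h
        simp only [Finset.coe_filter, Set.mem_toFinset, hS, Set.mem_ofPred_eq] at h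
        obtain ⟨⟨h1, -, h3⟩, rfl⟩ := h
        exact ⟨h1, h3⟩
      · rintro ⟨a', b⟩ h ⟨a'', b'⟩ h' hbb
        simp only [Finset.coe_filter, Set.mem_toFinset, Set.mem_ofPred_eq] at h h'
        exact Prod.ext (h.2.trans h'.2.symm) hbb
    refine h1.trans ((ncard_pow_eq_le hqp.pos (f ^ q) _ (fun b hb => hb.2)).trans
      (Nat.mul_le_mul_left _ ?_))
    refine (Set.ncard_le_ncard (Set.image_mono ?_)).trans
      (ncard_image_commutator_eq_le hc hqp hq hk a ⁅f, e⁆ ?_)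
    · rintro b ⟨hb, -⟩
      rw [Set.mem_ofPred_eq, ← commutatorElement_inv, hb, commutatorElement_inv]
    · rwa [← commutatorElement_inv, ne_eq, inv_eq_one]
  refine (Set.ncard_le_ncard hsub).trans ?_
  have h := Finset.card_le_mul_card_image (f := Prod.fst) S.toFinset _ hsnd
  rw [← Set.ncard_eq_toFinset_card', ← Set.toFinset_image, ← Set.ncard_eq_toFinset_card'] at h
  exact h.trans (Nat.mul_le_mul_left _ hfst)

/-- An automorphism fixing `Z(P)` and a noncommuting pair is determined by its restriction to the
centralizer of the pair. -/
theorem card_stabilizer_pair_le (hc : ∀ x y : P, ⁅x, y⁆ ∈ center P) {q : ℕ}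
    (hqp : q.Prime) (hq : ∀ x : P, x ^ q ∈ center P) {e f : P} (hef : ⁅e, f⁆ ≠ 1) :
    Nat.card (MulAction.stabilizer (fixingSubgroup (MulAut P) (center P : Set P)) (e, f)) ≤
      Nat.card (fixingSubgroup (MulAut (centralizer ({e, f} : Set P)))
        (center (centralizer ({e, f} : Set P)) : Set (centralizer ({e, f} : Set P)))) := by
  set C := centralizer ({e, f} : Set P)
  have hfix : ∀ γ : MulAction.stabilizer (fixingSubgroup (MulAut P) (center P : Set P)) (e, f),
      γ.1.1 e = e ∧ γ.1.1 f = f := fun γ => Prod.ext_iff.1 (MulAction.mem_stabilizer_iff.1 γ.2)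
  have hmem : ∀ (γ : MulAction.stabilizer (fixingSubgroup (MulAut P) (center P : Set P)) (e, f))
      (x : P), x ∈ C → γ.1.1 x ∈ C := by
    intro γ x hx
    obtain ⟨h1, h2⟩ := mem_centralizer_pair.1 hx
    obtain ⟨he, hf⟩ := hfix γ
    refine mem_centralizer_pair.2 ⟨?_, ?_⟩
    · have := map_commutatorElement γ.1.1 x e
      rwa [h1, map_one, he, eq_comm] at this
    · have := map_commutatorElement γ.1.1 x f
      rwa [h2, map_one, hf, eq_comm] at this
  let r : MulAction.stabilizer (fixingSubgroup (MulAut P) (center P : Set P)) (e, f) →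
      fixingSubgroup (MulAut C) (center C : Set C) := fun γ =>
    ⟨{ toFun := fun x => ⟨γ.1.1 x, hmem γ x x.2⟩
       invFun := fun x => ⟨(γ⁻¹).1.1 x, hmem γ⁻¹ x x.2⟩
       left_inv := fun x => Subtype.ext (γ.1.1.symm_apply_apply x)
       right_inv := fun x => Subtype.ext (γ.1.1.apply_symm_apply x)
       map_mul' := fun x y => Subtype.ext (map_mul γ.1.1 (x : P) y) }, by
      rw [mem_fixingSubgroup_iff]
      intro z hz
      have hz' : (z : P) ∈ center P := by
        rw [← map_center_centralizer_pair hc hqp hq hef]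
        exact ⟨z, hz, rfl⟩
      exact Subtype.ext ((mem_fixingSubgroup_iff _).1 γ.1.2 z hz')⟩
  refine Nat.card_le_card_of_injective r fun γ δ h => ?_
  have hC : ∀ x ∈ C, γ.1.1 x = δ.1.1 x := fun x hx =>
    congrArg Subtype.val (DFunLike.congr_fun (congrArg Subtype.val h) (⟨x, hx⟩ : C))
  refine Subtype.ext (Subtype.ext (MulEquiv.ext fun x => ?_))
  obtain ⟨i, j, hx⟩ := exists_mul_mem_centralizer_pair hc hqp hq hef x
  have := hC _ hx
  simpa [map_mul, map_zpow, (hfix γ).1, (hfix γ).2, (hfix δ).1, (hfix δ).2] using this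

end ClassTwoCount

section ClassTwoInduction

open Subgroup
open scoped commutatorElement

universe u

/-- If `P` has cyclic center and `P / Z(P)` is an elementary abelian `q`-group, then `P / Z(P)` has
order `q ^ (2 m)` and there are at most `q ^ (2 m) |Sp(2 m, q)|` automorphisms of `P` that fix
`Z(P)` pointwise. The proof splits off a hyperbolic pair of `P / Z(P)`. -/
theorem exists_index_center_card_fixingSubgroup_le {q : ℕ} (hqp : q.Prime) (N : ℕ) :
    ∀ (P : Type u) [Group P] [Finite P] [IsCyclic (center P)], Nat.card P = N →
      (∀ x y : P, ⁅x, y⁆ ∈ center P) → (∀ x : P, x ^ q ∈ center P) →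
      ∃ m : ℕ, (center P).index = q ^ (2 * m) ∧
        Nat.card (fixingSubgroup (MulAut P) (center P : Set P)) ≤
          q ^ (2 * m) * symplecticCard q m := by
  induction N using Nat.strong_induction_on with
  | _ N ih =>
  intro P _ _ _ hN hc hq
  by_cases hcomm : ∀ e f : P, ⁅e, f⁆ = 1
  · have htop : center P = ⊤ := eq_top_iff.2 fun x _ =>
      mem_center_iff.2 fun y => commutatorElement_eq_one_iff_mul_comm.1 (hcomm y x)
    refine ⟨0, by simp [htop], ?_⟩
    have : Subsingleton (fixingSubgroup (MulAut P) (center P : Set P)) := by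
      refine ⟨fun γ δ => Subtype.ext (MulEquiv.ext fun x => ?_)⟩
      have hx : x ∈ center P := htop ▸ mem_top x
      exact ((mem_fixingSubgroup_iff _).1 γ.2 x hx).trans
        ((mem_fixingSubgroup_iff _).1 δ.2 x hx).symm
    simp [symplecticCard]
  push Not at hcomm
  obtain ⟨e, f, hef⟩ := hcomm
  have hmap := map_center_centralizer_pair hc hqp hq hef
  have hidx := index_centralizer_pair hc hqp hq hef
  have hstab := card_stabilizer_pair_le hc hqp hq hef
  set C := centralizer ({e, f} : Set P)
  have hmem : ∀ x : C, (x : P) ∈ center P → x ∈ center C := fun x hx =>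
    mem_center_iff.2 fun y => Subtype.ext (mem_center_iff.1 hx y)
  have hcyc : IsCyclic (center C) := by
    refine isCyclic_of_injective (((C.subtype.comp (center C).subtype).codRestrict (center P)
      fun x => ?_)) ?_
    · rw [← hmap]; exact ⟨x, x.2, rfl⟩
    · exact fun x y h => Subtype.ext (Subtype.ext (congrArg (fun z : center P => (z : P)) h))
  have hlt : Nat.card C < N := by
    rw [← hN, ← C.card_mul_index, hidx]
    exact lt_mul_of_one_lt_right Nat.card_pos (Nat.one_lt_pow two_ne_zero hqp.one_lt)
  obtain ⟨m, hm, hcard⟩ := ih _ hlt C rfl (fun x y => hmem _ (hc x y)) (fun x => hmem _ (hq x))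
  have hindex : (center P).index = q ^ (2 * m + 1 + 1) := by
    rw [← hmap, index_map_subtype, hm, hidx, ← pow_add]
  refine ⟨m + 1, by rw [hindex]; congr 1, ?_⟩
  have horb := ncard_orbit_pair_le hc hqp hq hindex hef
  rw [← Subgroup.card_mul_index (MulAction.stabilizer
    (fixingSubgroup (MulAut P) (center P : Set P)) (e, f)), MulAction.index_stabilizer]
  refine (Nat.mul_le_mul (hstab.trans hcard) horb).trans (le_of_eq ?_)
  rw [symplecticCard_succ, show 2 * (m + 1) = 2 * m + 1 + 1 by ring]
  generalize q ^ (2 * m + 1 + 1) - 1 = t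
  ring

end ClassTwoInduction

/-! ### Extraspecial supplements of the center -/

section Extraspecial

open Subgroup
open scoped commutatorElement

theorem IsExtraspecial.of_mulEquiv {q : ℕ} {P Q : Type*} [Group P] [Group Q] (h : IsExtraspecial q P)
    (e : P ≃* Q) : IsExtraspecial q Q := by
  have hmap : (center P).map (e : P →* Q) = center Q := by
    ext x
    constructor
    · rintro ⟨y, hy, rfl⟩
      refine mem_center_iff.2 fun z => ?_
      have := congrArg e (mem_center_iff.1 hy (e.symm z))
      simpa using this
    · intro hx
      refine ⟨e.symm x, mem_center_iff.2 fun z => e.injective ?_, by simp⟩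
      simpa using mem_center_iff.1 hx (e z)
  let φ := QuotientGroup.congr (center P) (center Q) e hmap
  have := h.finite
  have := h.nontrivial_quotient
  exact {
    finite := Finite.of_equiv P e.toEquiv
    isPGroup := h.isPGroup.of_equiv e
    card_center := (Nat.card_congr (centerCongr e).toEquiv).symm.trans h.card_center
    nontrivial_quotient := φ.injective.nontrivial
    comm_quotient := fun a b => φ.symm.injective (by simpa using h.comm_quotient _ _)
    pow_quotient := fun a => φ.symm.injective (by simpa using h.pow_quotient _) }

variable {P : Type*} [Group P] [IsCyclic (center P)]

/-- For a noncommuting pair `e`, `f`, the `q`-th powers of `e` and `f` lie in a cyclic group, so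
some nontrivial "linear combination" `e ^ i * f ^ j` can be corrected by a central element so as
to have order dividing `q ^ 2`. -/
theorem exists_notMem_center_pow_sq_eq_one (hc : ∀ x y : P, ⁅x, y⁆ ∈ center P) {q : ℕ}
    (hqp : q.Prime) (hq : ∀ x : P, x ^ q ∈ center P) {e f : P} (hef : ⁅e, f⁆ ≠ 1) :
    ∃ x ∉ center P, ∃ z ∈ center P, (x * z) ^ q ^ 2 = 1 := by
  have := Fact.mk hqp
  obtain ⟨ζ, hζ⟩ := IsCyclic.exists_generator (α := center P)
  obtain ⟨a, ha⟩ := mem_zpowers_iff.1 (hζ ⟨e ^ q, hq e⟩)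
  obtain ⟨b, hb⟩ := mem_zpowers_iff.1 (hζ ⟨f ^ q, hq f⟩)
  replace ha : (ζ : P) ^ a = e ^ q := by simpa using congrArg (fun z : center P => (z : P)) ha
  replace hb : (ζ : P) ^ b = f ^ q := by simpa using congrArg (fun z : center P => (z : P)) hb
  by_cases hqa : (q : ℤ) ∣ a
  · obtain ⟨a', rfl⟩ := hqa
    refine ⟨e, fun h => hef (commutator_eq_one_of_mem_center_left h f), (ζ : P) ^ (-a'),
      zpow_mem ζ.2 _, ?_⟩
    have hcomm : Commute e ((ζ : P) ^ (-a')) := mem_center_iff.1 (zpow_mem ζ.2 (-a')) e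
    rw [pow_two, pow_mul, hcomm.mul_pow, ← ha, ← zpow_natCast ((ζ : P) ^ (-a')), ← zpow_mul,
      ← zpow_add]
    simp [mul_comm]
  · -- with `e ^ q = ζ ^ a` and `f ^ q = ζ ^ b`, the `q`-th power of `e ^ b * f ^ (-a)` is `1` up to
    -- commutators, which have order dividing `q`
    refine ⟨e ^ b * f ^ (-a), fun h => hqa ?_, 1, one_mem _, ?_⟩
    · have h1 := commutator_eq_one_of_mem_center_left h e
      rw [commutator_mul_left hc, commutator_zpow_left hc, commutator_zpow_left hc,
        commutatorElement_self, one_zpow, one_mul, zpow_neg, inv_eq_one,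
        ← commutatorElement_inv, inv_zpow, inv_eq_one] at h1
      rw [← orderOf_eq_prime (commutator_pow_eq_one hc (hq e) f) hef]
      exact orderOf_dvd_iff_zpow_eq_one.2 h1
    · rw [mul_one, mul_pow_pow_eq hc hq, ← zpow_natCast, ← zpow_natCast, ← zpow_mul, ← zpow_mul]
      have h1 : e ^ (b * ((q ^ 2 : ℕ) : ℤ)) = (e ^ q) ^ (b * q) := by
        rw [← zpow_natCast, ← zpow_mul]; congr 1; push_cast; ring
      have h2 : f ^ (-a * ((q ^ 2 : ℕ) : ℤ)) = (f ^ q) ^ (-a * q) := by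
        rw [← zpow_natCast, ← zpow_mul]; congr 1; push_cast; ring
      rw [h1, h2, ← ha, ← hb, ← zpow_mul, ← zpow_mul, ← zpow_add, ← zpow_zero (ζ : P)]
      congr 1
      ring

/-- The elements of order dividing `q ^ 2` supplement the center; in this subgroup `E`, a subgroup
maximal among those that contain `P'` and meet the center in `P'` is extraspecial, and is still a
supplement of the center because `E / P'` is elementary abelian. -/
theorem exists_isExtraspecial_sup_eq_top [Finite P] (hc : ∀ x y : P, ⁅x, y⁆ ∈ center P) {q : ℕ}
    (hqp : q.Prime) (hq : ∀ x : P, x ^ q ∈ center P) {e f : P} (hef : ⁅e, f⁆ ≠ 1)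
    (hE : ∀ x : P, ∃ z ∈ center P, (x * z) ^ q ^ 2 = 1) :
    ∃ Q : Subgroup P, IsExtraspecial q Q ∧ center P ⊔ Q = ⊤ := by
  have := Fact.mk hqp
  set c := ⁅e, f⁆ with hcdef
  have hcq : c ^ q = 1 := commutator_pow_eq_one hc (hq e) f
  have hgen : ∀ z ∈ center P, z ^ q = 1 → z ∈ zpowers c := fun z hz hzq =>
    mem_zpowers_of_pow_eq_one hqp (hc e f) hcq hef hz hzq
  have hcZ : zpowers c ≤ center P := zpowers_le.2 (hc e f)
  have hcomm : ∀ x y : P, ⁅x, y⁆ ∈ zpowers c := fun x y =>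
    hgen _ (hc x y) (commutator_pow_eq_one hc (hq x) y)
  obtain ⟨Q, hQ⟩ := Set.Finite.exists_maximal
    (s := {Q : Subgroup P | zpowers c ≤ Q ∧ (∀ y ∈ Q, y ^ q ^ 2 = 1) ∧ Q ⊓ center P ≤ zpowers c})
    (Set.toFinite _) ⟨zpowers c, le_rfl, fun y hy => by
      obtain ⟨i, rfl⟩ := mem_zpowers_iff.1 hy
      rw [← zpow_natCast, ← zpow_mul, mul_comm, zpow_mul, zpow_natCast, pow_two, pow_mul, hcq,
        one_pow, one_zpow], inf_le_left⟩
  obtain ⟨hcQ, hQE, hQZ⟩ := hQ.prop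
  have hQn : Q.Normal := ⟨fun n hn g => by
    have h1 : g * n * g⁻¹ = ⁅g, n⁆ * n := by rw [commutatorElement_def]; group
    rw [h1]
    exact mul_mem (hcQ (hcomm g n)) hn⟩
  have hEQ : ∀ x : P, x ^ q ^ 2 = 1 → x ∈ center P ⊔ Q := by
    intro x hx
    by_contra hxQ
    have hxq : x ^ q ∈ zpowers c := hgen _ (hq x) (by rw [← pow_mul, ← pow_two, hx])
    have hmax := hQ.le_of_ge (y := Q ⊔ zpowers x) ⟨hcQ.trans le_sup_left, ?_, ?_⟩ le_sup_left
    · exact hxQ (mem_sup_right (hmax (mem_sup_right (mem_zpowers x))))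
    · intro y hy
      obtain ⟨y, hyQ, z, hz, rfl⟩ := mem_sup_of_normal_left.1 hy
      obtain ⟨i, rfl⟩ := mem_zpowers_iff.1 hz
      rw [mul_pow_pow_eq hc hq, hQE y hyQ, ← zpow_natCast, ← zpow_mul, mul_comm, zpow_mul,
        zpow_natCast, hx, one_zpow, one_mul]
    · rintro w ⟨hw, hwZ⟩
      obtain ⟨y, hy, z, hz, rfl⟩ := mem_sup_of_normal_left.1 hw
      obtain ⟨i, rfl⟩ := mem_zpowers_iff.1 hz
      by_cases hqi : (q : ℤ) ∣ i
      · obtain ⟨k, rfl⟩ := hqi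
        refine hQZ ⟨mul_mem hy ?_, hwZ⟩
        rw [zpow_mul, zpow_natCast]
        exact zpow_mem (hcQ hxq) k
      · exfalso
        -- `x ^ i` and `x ^ q` lie in `Z(P) Q`, and `i` is prime to `q`
        have hi : x ^ i ∈ center P ⊔ Q := by
          have := mul_mem (inv_mem (mem_sup_right hy : y ∈ center P ⊔ Q))
            (mem_sup_left hwZ : y * x ^ i ∈ center P ⊔ Q)
          rwa [inv_mul_cancel_left] at this
        have hcop : IsCoprime (q : ℤ) i :=
          (Nat.prime_iff_prime_int.1 hqp).coprime_iff_not_dvd.2 hqi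
        obtain ⟨a, b, hab⟩ := hcop
        refine hxQ ?_
        have h1 : x = (x ^ q) ^ a * (x ^ i) ^ b := by
          rw [← zpow_natCast, ← zpow_mul, ← zpow_mul, ← zpow_add, mul_comm _ a, mul_comm i b,
            hab, zpow_one]
        rw [h1]
        exact mul_mem (zpow_mem (mem_sup_right (hcQ hxq)) a) (zpow_mem hi b)
  have htop : center P ⊔ Q = ⊤ := by
    refine eq_top_iff.2 fun x _ => ?_
    obtain ⟨z, hz, hxz⟩ := hE x
    have := mul_mem (hEQ _ hxz) (mem_sup_left (inv_mem hz) : z⁻¹ ∈ center P ⊔ Q)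
    rwa [mul_inv_cancel_right] at this
  have hcenter : ∀ z : Q, z ∈ center Q ↔ (z : P) ∈ zpowers c := by
    intro z
    constructor
    · intro hz
      refine hQZ ⟨z.2, mem_center_iff.2 fun x => ?_⟩
      obtain ⟨w, hw, y, hy, rfl⟩ := mem_sup_of_normal_left.1 (htop ▸ mem_top x : x ∈ center P ⊔ Q)
      have h1 : Commute w (z : P) := (mem_center_iff.1 hw z).symm
      have h2 : Commute y (z : P) := congrArg Subtype.val (mem_center_iff.1 hz ⟨y, hy⟩)
      exact h1.mul_left h2
    · exact fun hz => mem_center_iff.2 fun x => Subtype.ext (mem_center_iff.1 (hcZ hz) x)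
  refine ⟨Q, ?_, htop⟩
  exact {
    finite := inferInstance
    isPGroup := fun g => ⟨2, Subtype.ext (hQE g g.2)⟩
    card_center := by
      have hmap : (center Q).map Q.subtype = zpowers c := by
        ext z
        constructor
        · rintro ⟨z, hz, rfl⟩
          exact (hcenter z).1 hz
        · exact fun hz => ⟨⟨z, hcQ hz⟩, (hcenter _).2 hz, rfl⟩
      rw [← orderOf_eq_prime hcq hef, ← Nat.card_zpowers, ← hmap]
      exact Nat.card_congr (equivMapOfInjective _ _ Q.subtype_injective).toEquiv
    nontrivial_quotient := by
      by_contra hnt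
      rw [not_nontrivial_iff_subsingleton, QuotientGroup.subsingleton_iff] at hnt
      have hQcZ : Q ≤ center P := fun z hz =>
        hcZ ((hcenter ⟨z, hz⟩).1 (hnt ▸ mem_top _))
      rw [sup_of_le_left hQcZ] at htop
      exact hef (commutator_eq_one_of_mem_center_left (htop ▸ mem_top e) f)
    comm_quotient := by
      rintro ⟨a⟩ ⟨b⟩
      refine QuotientGroup.eq.2 ((hcenter _).2 ?_)
      have h1 : (((a * b)⁻¹ * (b * a) : Q) : P) = ⁅(b : P)⁻¹, (a : P)⁻¹⁆ := by
        simp [commutatorElement_def]; group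
      rw [h1]
      exact hcomm _ _
    pow_quotient := by
      rintro ⟨a⟩
      refine (QuotientGroup.eq_one_iff (a ^ q)).2 ((hcenter _).2 (hgen _ (hq a) ?_))
      rw [coe_pow, ← pow_mul, ← pow_two]
      exact hQE a a.2 }

end Extraspecial

/-! ### Minimal noncentral normal subgroups inside the Fitting subgroup -/

section MinimalNormal

open Subgroup
open scoped commutatorElement

variable {G : Type*} [Group G]

/-- If `M / Z(G)` is a minimal normal subgroup of `G / Z(G)`, then a nilpotent normal subgroup `N`
centralizes it: otherwise `M = ⁅M, N⁆ Z(G)`, and iterating puts `M` into the product of `Z(G)` with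
every term of the lower central series of `N`. -/
theorem commutator_le_center_of_isNilpotent {M N : Subgroup G} [M.Normal] [N.Normal]
    (hM : center G < M)
    (hmin : ∀ L : Subgroup G, L.Normal → center G < L → L ≤ M → L = M)
    (hN : Group.IsNilpotent N) : ⁅M, N⁆ ≤ center G := by
  by_contra hcon
  have hL : ⁅M, N⁆ ⊔ center G = M := by
    refine hmin _ inferInstance (lt_of_le_of_ne le_sup_right fun h => hcon ?_)
      (sup_le (commutator_le_left M N) hM.le)
    rw [h]; exact le_sup_left
  have key : ∀ K : Subgroup G, K.Normal → M ≤ K ⊔ center G → M ≤ ⁅K, N⁆ ⊔ center G := by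
    intro K _ hK
    refine hL.symm.le.trans (sup_le_sup_right ?_ _)
    rw [commutator_le]
    intro g hg n hn
    obtain ⟨k, hk, z, hz, rfl⟩ := mem_sup_of_normal_right.1 (hK hg)
    rw [commutatorElement_mul_left_eq_conj_mul, commutator_eq_one_of_mem_center_left hz]
    simpa using commutator_mem_commutator hk hn
  obtain ⟨n, hn⟩ := (isNilpotent_iff_lowerCentralSeries N).1 hN
  have hall : ∀ k, M ≤ N.lowerCentralSeries k ⊔ center G := by
    intro k
    induction k with
    | zero => exact hL.symm.le.trans (sup_le_sup_right (commutator_le_right M N) _)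
    | succ k ih => exact key _ inferInstance ih
  have := hall n
  rw [hn, bot_sup_eq] at this
  exact hM.not_ge this

theorem commutator_fittingSubgroup_le_center {M : Subgroup G} [M.Normal]
    (hM : center G < M)
    (hmin : ∀ L : Subgroup G, L.Normal → center G < L → L ≤ M → L = M) :
    ∀ x ∈ M, ∀ y ∈ fittingSubgroup G, ⁅x, y⁆ ∈ center G := by
  intro x hx y hy
  have hle : fittingSubgroup G ≤
      (centralizer (M.map (QuotientGroup.mk' (center G)) : Set (G ⧸ center G))).comap
        (QuotientGroup.mk' (center G)) := by
    refine sSup_le ?_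
    rintro N ⟨hNn, hN⟩ n hn
    rw [mem_comap, mem_centralizer_iff]
    rintro _ ⟨m, hm, rfl⟩
    rw [← commutatorElement_eq_one_iff_mul_comm, ← map_commutatorElement]
    exact (QuotientGroup.eq_one_iff _).2
      (commutator_le_center_of_isNilpotent hM hmin hN (commutator_mem_commutator hm hn))
  have h := mem_centralizer_iff.1 (hle hy) _ (mem_map_of_mem _ hx)
  rw [← commutatorElement_eq_one_iff_mul_comm, ← map_commutatorElement] at h
  exact (QuotientGroup.eq_one_iff _).1 h

/-- The structure of a minimal `M`, as far as it depends only on `G` as an abstract group with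
cyclic center in which abelian normal subgroups are central: here `Z(M) = Z(G)`, and `M / Z(M)` is
an elementary abelian `q`-group on which the commutator form is symplectic. -/
theorem exists_prime_of_minimal_normal [Finite G] [IsCyclic (center G)]
    (habel : ∀ A : Subgroup G, A.Normal → IsMulCommutative A → A ≤ center G)
    {M : Subgroup G} [hMn : M.Normal] (hM : center G < M)
    (hmin : ∀ L : Subgroup G, L.Normal → center G < L → L ≤ M → L = M)
    (hMF : M ≤ fittingSubgroup G) :
    ∃ q m : ℕ, q.Prime ∧ 0 < m ∧
      (∀ x ∈ M, x ∉ center G → ∃ y ∈ M, ⁅y, x⁆ ≠ 1 ∧ ⁅y, x⁆ ∈ center G) ∧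
      Nat.card M = Nat.card (center G) * q ^ (2 * m) ∧
      (∃ Q : Subgroup G, IsExtraspecial q Q ∧ Nat.card Q = q ^ (2 * m + 1) ∧
        M = center G ⊔ Q) ∧
      (M ⊔ centralizer (M : Set G)).index ≤ symplecticCard q m ∧
      (centralizer (M : Set G)).index ≤ q ^ (2 * m) * symplecticCard q m := by
  have hcom := commutator_fittingSubgroup_le_center hM hmin
  -- `Z(M) = Z(G)`
  have hinf : M ⊓ centralizer (M : Set G) ≤ center G := by
    refine habel _ inferInstance ⟨⟨fun a b => Subtype.ext ?_⟩⟩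
    exact mem_centralizer_iff.1 b.2.2 a a.2.1
  have hcen : ∀ x : M, x ∈ center M ↔ (x : G) ∈ center G := by
    intro x
    constructor
    · intro hx
      refine hinf ⟨x.2, mem_centralizer_iff.2 fun y hy => ?_⟩
      exact congrArg Subtype.val (mem_center_iff.1 hx ⟨y, hy⟩)
    · exact fun hx => mem_center_iff.2 fun y => Subtype.ext (mem_center_iff.1 hx y)
  have hmap : (center M).map M.subtype = center G := by
    ext z
    constructor
    · rintro ⟨z, hz, rfl⟩
      exact (hcen z).1 hz
    · exact fun hz => ⟨⟨z, hM.le hz⟩, (hcen _).2 hz, rfl⟩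
  have hcardZ : Nat.card (center M) = Nat.card (center G) := by
    rw [← hmap]
    exact Nat.card_congr (equivMapOfInjective _ _ M.subtype_injective).toEquiv
  have hcyc : IsCyclic (center M) := by
    refine isCyclic_of_injective (((M.subtype.comp (center M).subtype).codRestrict (center G)
      fun x => (hcen x).1 x.2)) ?_
    exact fun x y h => Subtype.ext (Subtype.ext (congrArg (fun z : center G => (z : G)) h))
  have hc : ∀ x y : M, ⁅x, y⁆ ∈ center M := fun x y =>
    (hcen _).2 (hcom x x.2 y (hMF y.2))
  -- subgroups of `M` that contain `Z(M)` properly and are stable under automorphisms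
  have hchar : ∀ K : Subgroup M, center M ≤ K → (∀ (γ : MulAut M), ∀ x ∈ K, γ x ∈ K) →
      (∃ x ∈ K, x ∉ center M) → K = ⊤ := by
    rintro K hZK hK ⟨x, hxK, hx⟩
    have h1 : K.map M.subtype = M := by
      refine hmin _ ⟨?_⟩ (lt_of_le_of_ne ?_ ?_) (map_subtype_le K)
      · rintro _ ⟨y, hy, rfl⟩ g
        exact ⟨MulAut.conjNormal g y, hK _ y hy, MulAut.conjNormal_apply g y⟩
      · rw [← hmap]; exact Subgroup.map_mono hZK
      · intro h
        exact hx ((hcen x).2 (h ▸ mem_map_of_mem M.subtype hxK))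
    rw [← map_subtype_inj, h1, ← MonoidHom.range_eq_map, range_subtype]
  have hcharZ : ∀ (γ : MulAut M), ∀ x ∈ center M, γ x ∈ center M := fun γ x hx =>
    mem_center_iff.2 fun y => by simpa using congrArg γ (mem_center_iff.1 hx (γ⁻¹ y))
  -- the prime `q`
  obtain ⟨q, hqp, hq⟩ : ∃ q : ℕ, q.Prime ∧ ∀ x : M, x ^ q ∈ center M := by
    obtain ⟨x, hxM, hx⟩ := SetLike.exists_of_lt hM
    have hx' : (⟨x, hxM⟩ : M) ∉ center M := fun h => hx ((hcen _).1 h)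
    set k := orderOf ((⟨x, hxM⟩ : M) : M ⧸ center M) with hk
    have hk1 : k ≠ 1 := fun h => hx' ((QuotientGroup.eq_one_iff _).1 (orderOf_eq_one_iff.1 h))
    have hk0 : 0 < k := orderOf_pos _
    -- `x ^ (k / q)` is noncentral with central `q`-th power, for `q` the least prime factor of `k`
    refine ⟨k.minFac, Nat.minFac_prime hk1, ?_⟩
    let K : Subgroup M :=
      { carrier := {y | y ^ k.minFac ∈ center M}
        one_mem' := by simp
        mul_mem' := fun ha hb => mul_pow_mem_center hc ha hb
        inv_mem' := fun {a} ha => by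
          simpa using inv_mem (show a ^ k.minFac ∈ center M from ha) }
    have hKtop : K = ⊤ := by
      refine hchar K (fun y hy => pow_mem hy _) (fun γ y hy => ?_)
        ⟨(⟨x, hxM⟩ : M) ^ (k / k.minFac), ?_, fun h => ?_⟩
      · have := hcharZ γ _ hy
        rwa [map_pow] at this
      · change ((⟨x, hxM⟩ : M) ^ (k / k.minFac)) ^ k.minFac ∈ center M
        rw [← pow_mul, Nat.div_mul_cancel k.minFac_dvd, ← QuotientGroup.eq_one_iff]
        exact pow_orderOf_eq_one ((⟨x, hxM⟩ : M) : M ⧸ center M)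
      · have h1 : ((⟨x, hxM⟩ : M) : M ⧸ center M) ^ (k / k.minFac) = 1 :=
          (QuotientGroup.eq_one_iff _).2 h
        have h2 : k / k.minFac < k := Nat.div_lt_self hk0 (Nat.minFac_prime hk1).one_lt
        exact pow_ne_one_of_lt_orderOf
          (Nat.div_pos (Nat.minFac_le hk0) k.minFac_pos).ne' h2 h1
    intro y
    have : y ∈ K := hKtop ▸ mem_top y
    exact this
  obtain ⟨e, f, hef⟩ : ∃ e f : M, ⁅e, f⁆ ≠ 1 := by
    obtain ⟨x, hxM, hx⟩ := SetLike.exists_of_lt hM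
    by_contra! h
    exact hx ((hcen ⟨x, hxM⟩).1 (mem_center_iff.2 fun y =>
      commutatorElement_eq_one_iff_mul_comm.1 (h y _)))
  -- the elements that a central factor brings to order dividing `q ^ 2` form such a subgroup
  have hE : ∀ x : M, ∃ z ∈ center M, (x * z) ^ q ^ 2 = 1 := by
    let K : Subgroup M :=
      { carrier := {x | ∃ z ∈ center M, (x * z) ^ q ^ 2 = 1}
        one_mem' := ⟨1, one_mem _, by simp⟩
        mul_mem' := by
          rintro a b ⟨z, hz, haz⟩ ⟨w, hw, hbw⟩
          refine ⟨z * w, mul_mem hz hw, ?_⟩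
          have : a * b * (z * w) = (a * z) * (b * w) := by
            rw [mul_assoc a b, ← mul_assoc b z, mem_center_iff.1 hz b, mul_assoc z, mul_assoc a]
          rw [this, mul_pow_pow_eq hc hq, haz, hbw, one_mul]
        inv_mem' := by
          rintro a ⟨z, hz, haz⟩
          refine ⟨z⁻¹, inv_mem hz, ?_⟩
          rw [← mul_inv_rev, ← mem_center_iff.1 hz a, inv_pow, haz, inv_one] }
    have hKtop : K = ⊤ := by
      refine hchar K (fun y hy => ⟨y⁻¹, inv_mem hy, by simp⟩) ?_ ?_
      · rintro γ x ⟨z, hz, hxz⟩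
        refine ⟨γ z, hcharZ γ z hz, ?_⟩
        rw [← map_mul, ← map_pow, hxz, map_one]
      · obtain ⟨x, hx, hx'⟩ := exists_notMem_center_pow_sq_eq_one hc hqp hq hef
        exact ⟨x, hx', hx⟩
    intro x
    have : x ∈ K := hKtop ▸ mem_top x
    exact this
  obtain ⟨m, hm, hcard⟩ :=
    exists_index_center_card_fixingSubgroup_le hqp _ M rfl hc hq
  have hm0 : 0 < m := by
    rcases Nat.eq_zero_or_pos m with rfl | h
    · exfalso
      have htop : center M = ⊤ := index_eq_one.1 (by simpa using hm)
      exact hef (commutator_eq_one_of_mem_center_left (htop ▸ mem_top e) f)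
    · exact h
  have hcardM : Nat.card M = Nat.card (center G) * q ^ (2 * m) := by
    rw [← hcardZ, ← hm, card_mul_index]
  -- `G / C(M)` acts faithfully on `M`, trivially on `Z(M) = Z(G)`
  have hC : (centralizer (M : Set G)).index ≤ q ^ (2 * m) * symplecticCard q m := by
    have hker : (MulAut.conjNormal : G →* MulAut M).ker = centralizer (M : Set G) := by
      ext g
      rw [MonoidHom.mem_ker, mem_centralizer_iff]
      constructor
      · intro h x hx
        have h1 := MulAut.conjNormal_apply g (⟨x, hx⟩ : M)
        rw [h] at h1
        exact eq_mul_inv_iff_mul_eq.1 h1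
      · intro h
        refine MulEquiv.ext fun x => Subtype.ext ?_
        rw [MulAut.conjNormal_apply, ← h x x.2, mul_inv_cancel_right]
        rfl
    have hrange : (MulAut.conjNormal : G →* MulAut M).range ≤
        fixingSubgroup (MulAut M) (center M : Set M) := by
      rintro _ ⟨g, rfl⟩
      rw [mem_fixingSubgroup_iff]
      intro z hz
      refine Subtype.ext ?_
      change ((MulAut.conjNormal g z : M) : G) = z
      rw [MulAut.conjNormal_apply, mem_center_iff.1 ((hcen z).1 hz) g, mul_inv_cancel_right]
    rw [← hker, index_ker]
    exact (Nat.card_le_card_of_injective _ (inclusion_injective hrange)).trans hcard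
  refine ⟨q, m, hqp, hm0, ?_, hcardM, ?_, ?_, hC⟩
  · intro x hxM hx
    by_contra! h
    refine hx ((hcen ⟨x, hxM⟩).1 (mem_center_iff.2 fun y => ?_))
    by_contra hxy
    refine h y y.2 (fun h1 => hxy (Subtype.ext ?_)) (hcom y y.2 x (hMF hxM))
    exact commutatorElement_eq_one_iff_mul_comm.1 h1
  · obtain ⟨Q, hQ, hQtop⟩ := exists_isExtraspecial_sup_eq_top hc hqp hq hef hE
    let e := Q.equivMapOfInjective M.subtype M.subtype_injective
    refine ⟨Q.map M.subtype, hQ.of_mulEquiv e, ?_, ?_⟩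
    · have hZQ : (center M).subgroupOf Q = center Q := by
        ext z
        rw [mem_subgroupOf]
        constructor
        · exact fun hz => mem_center_iff.2 fun x => Subtype.ext (mem_center_iff.1 hz x)
        · intro hz
          refine mem_center_iff.2 fun x => ?_
          obtain ⟨w, hw, y, hy, rfl⟩ :=
            mem_sup_of_normal_left.1 (hQtop ▸ mem_top x : x ∈ center M ⊔ Q)
          have h1 : Commute w (z : M) := (mem_center_iff.1 hw z).symm
          have h2 : Commute y (z : M) := congrArg Subtype.val (mem_center_iff.1 hz ⟨y, hy⟩)
          exact h1.mul_left h2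
      have hrel : (center Q).index = q ^ (2 * m) := by
        rw [← hm, ← hZQ]
        change (center M).relIndex Q = _
        rw [← relIndex_sup_left, hQtop, relIndex_top_right]
      rw [← Nat.card_congr e.toEquiv, ← (center Q).card_mul_index, hrel, hQ.card_center]
      ring
    · rw [← hmap, ← Subgroup.map_sup, hQtop, ← MonoidHom.range_eq_map, range_subtype]
  · have hrel : (centralizer (M : Set G)).relIndex (M ⊔ centralizer (M : Set G)) =
        q ^ (2 * m) := by
      rw [relIndex_sup_right, ← hm, relIndex]
      congr 1
      ext z
      rw [hcen, mem_subgroupOf]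
      exact ⟨fun h => hinf ⟨z.2, h⟩, fun h => center_le_centralizer _ h⟩
    have h1 := relIndex_mul_index (le_sup_right : centralizer (M : Set G) ≤
      M ⊔ centralizer (M : Set G))
    rw [hrel] at h1
    exact Nat.le_of_mul_le_mul_left (h1 ▸ hC) (pow_pos hqp.pos _)

end MinimalNormal

/-! ### Primitive linear groups -/

section LinearGroups

open Subgroup Module
open scoped commutatorElement

/-- If `ρ` is scalar on a subgroup `Z` and its character vanishes off `Z`, then
`|Z| (dim ρ) ^ 2 / |M|` is the integer `⟨χ, χ⟩ = dim End_M(ρ)`. -/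
theorem card_dvd_card_mul_finrank_sq {M V : Type*} [Group M] [Finite M] [AddCommGroup V]
    [Module ℂ V] [FiniteDimensional ℂ V] (ρ : Representation ℂ M V) (Z : Subgroup M)
    (hZ : ∀ z ∈ Z, ∃ c : ℂ, ρ z = c • 1) (h0 : ∀ x ∉ Z, ρ.character x = 0) :
    Nat.card M ∣ Nat.card Z * finrank ℂ V ^ 2 := by
  classical
  have := Fintype.ofFinite M
  have hM : (Nat.card M : ℂ) ≠ 0 := Nat.cast_ne_zero.2 Nat.card_pos.ne'
  have : Invertible (Nat.card M : ℂ) := invertibleOfNonzero hM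
  rcases subsingleton_or_nontrivial V with hV | hV
  · simp [finrank_zero_of_subsingleton]
  have key : ∀ x : M, ρ.character x * ρ.character x⁻¹ =
      if x ∈ Z then (finrank ℂ V : ℂ) ^ 2 else 0 := by
    intro x
    split_ifs with hx
    · obtain ⟨c, hc⟩ := hZ x hx
      obtain ⟨d, hd⟩ := hZ x⁻¹ (inv_mem hx)
      have hcd : c * d = 1 := by
        obtain ⟨v, hv⟩ := exists_ne (0 : V)
        have h1 : ρ (x * x⁻¹) v = v := by simp
        rw [map_mul, hc, hd] at h1
        have h2 : (c * d) • v = (1 : ℂ) • v := by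
          rw [mul_comm, mul_smul, one_smul]; simpa using h1
        exact smul_left_injective ℂ hv h2
      simp only [Representation.character, hc, hd, map_smul, LinearMap.trace_one, smul_eq_mul]
      linear_combination (finrank ℂ V : ℂ) ^ 2 * hcd
    · rw [h0 x hx, zero_mul]
  have h := Representation.card_inv_mul_sum_char_mul_char_eq_finrank ρ ρ
  rw [Finset.sum_congr rfl (fun x _ => key x), ← Finset.sum_filter, Finset.sum_const,
    inv_mul_eq_iff_eq_mul₀ hM, nsmul_eq_mul] at h
  have hcard : (Finset.univ.filter (fun x => x ∈ Z)).card = Nat.card Z := by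
    rw [Nat.card_eq_fintype_card, Fintype.card_subtype]
  rw [hcard] at h
  exact ⟨_, by exact_mod_cast h⟩

variable {n : ℕ} {G : Subgroup (Matrix.GeneralLinearGroup (Fin n) ℂ)}

theorem naturalRep_injective (G : Subgroup (Matrix.GeneralLinearGroup (Fin n) ℂ)) :
    Function.Injective (naturalRep G) := fun _ _ h =>
  Subtype.ext (Matrix.GeneralLinearGroup.toLin.injective (Units.ext h))

/-- Clifford's theorem for a primitive linear group: `G` permutes the common eigenspaces of an
abelian normal subgroup `A`, so that there is only one of them. -/
theorem IsPrimitiveLinearGroup.exists_eq_smul_one [Finite G] (hG : IsPrimitiveLinearGroup G)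
    (A : Subgroup G) [A.Normal] [IsMulCommutative A] (a : G) (ha : a ∈ A) :
    ∃ c : ℂ, naturalRep G a = c • 1 := by
  set ρ := naturalRep G
  have hfin : ∀ (x : G) (μ : ℂ),
      Module.End.maxGenEigenspace (ρ x) μ = Module.End.eigenspace (ρ x) μ := by
    intro x μ
    refine Module.End.IsFinitelySemisimple.maxGenEigenspace_eq_eigenspace
      (Module.End.isFinitelySemisimple_iff_isSemisimple.2 ?_) μ
    have hcard : (Nat.card G : ℂ) ≠ 0 := Nat.cast_ne_zero.2 Nat.card_pos.ne'
    refine Module.End.isSemisimple_of_squarefree_aeval_eq_zero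
      (Polynomial.X_pow_sub_one_separable_iff.2 hcard).squarefree ?_
    rw [map_sub, Polynomial.aeval_one, map_pow, Polynomial.aeval_X, ← map_pow, pow_card_eq_one',
      map_one, sub_self]
  let W : (A → ℂ) → Submodule ℂ (Fin n → ℂ) := fun χ =>
    ⨅ x : A, Module.End.maxGenEigenspace (ρ x) (χ x)
  have hmemW : ∀ χ v, v ∈ W χ ↔ ∀ x : A, ρ x v = χ x • v := by
    intro χ v
    simp only [W, Submodule.mem_iInf, hfin, Module.End.mem_eigenspace_iff]
  have hcomm : ∀ x y : A, Commute (ρ x) (ρ y) := fun x y => by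
    have : (x : G) * y = y * x := congrArg Subtype.val (mul_comm' x y)
    rw [commute_iff_eq, ← map_mul, ← map_mul, this]
  have hind : iSupIndep W :=
    Module.End.independent_iInf_maxGenEigenspace_of_forall_mapsTo (fun x : A => ρ x)
      fun x y => Module.End.mapsTo_maxGenEigenspace_of_comm (hcomm y x)
  have htop : ⨆ χ, W χ = ⊤ :=
    Module.End.iSup_iInf_maxGenEigenspace_eq_top_of_iSup_maxGenEigenspace_eq_top_of_commute
      (fun x : A => ρ x) (fun x y _ => hcomm x y)
      fun x => Module.End.iSup_maxGenEigenspace_eq_top _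
  have hperm : ∀ (g : G) (χ : A → ℂ), (W χ).map (ρ g) =
      W fun x => χ ((MulAut.conjNormal g)⁻¹ x) := by
    have hle : ∀ (g : G) (χ : A → ℂ) (v), v ∈ W χ →
        ρ g v ∈ W fun x => χ ((MulAut.conjNormal g)⁻¹ x) := by
      intro g χ v hv
      rw [hmemW] at hv ⊢
      intro x
      have h1 : (x : G) * g = g * ((MulAut.conjNormal g)⁻¹ x : A) := by
        rw [MulAut.conjNormal_inv_apply]; group
      rw [← Module.End.mul_apply, ← map_mul, h1, map_mul, Module.End.mul_apply, hv, map_smul]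
    intro g χ
    refine le_antisymm (Submodule.map_le_iff_le_comap.2 fun v hv => hle g χ v hv) fun v hv => ?_
    refine ⟨ρ g⁻¹ v, ?_, ?_⟩
    · have := hle g⁻¹ _ v hv
      have hχ : (fun x => χ ((MulAut.conjNormal g)⁻¹ ((MulAut.conjNormal g⁻¹)⁻¹ x))) = χ :=
        funext fun x => by rw [map_inv, inv_inv, MulAut.inv_apply_self]
      rwa [hχ] at this
    · rw [← Module.End.mul_apply, ← map_mul, mul_inv_cancel, map_one, Module.End.one_apply]
  have hne : {χ | W χ ≠ ⊥}.Finite := WellFoundedGT.finite_ne_bot_of_iSupIndep hind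
  have := hne.fintype
  let e := Fintype.equivFin {χ | W χ ≠ ⊥}
  have hk := hG.no_imprimitivity _ (fun i => W (e.symm i)) ?_ (fun i => (e.symm i).2) ?_
  rotate_left
  · refine DirectSum.isInternal_submodule_of_iSupIndep_of_iSup_eq_top
      (hind.comp (Subtype.val_injective.comp e.symm.injective)) ?_
    rw [← htop, e.symm.iSup_comp (g := fun χ : {χ | W χ ≠ ⊥} => W χ)]
    exact iSup_ne_bot_subtype W
  · intro g i
    refine ⟨e ⟨fun x => (e.symm i : A → ℂ) ((MulAut.conjNormal g)⁻¹ x), ?_⟩, ?_⟩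
    · change W _ ≠ ⊥
      rw [← hperm]
      intro h
      refine (e.symm i).2 (eq_bot_iff.2 fun v hv => ?_)
      have h1 : ρ g v = 0 := by
        have := Submodule.mem_map_of_mem (f := ρ g) hv
        rwa [h] at this
      have h2 : ρ (g⁻¹ * g) v = 0 := by rw [map_mul, Module.End.mul_apply, h1, map_zero]
      simpa using h2
    · rw [Equiv.symm_apply_apply]
      exact hperm g _
  have hex : ∃ χ, W χ = ⊤ := by
    have hsub : Subsingleton {χ | W χ ≠ ⊥} := Fintype.card_le_one_iff_subsingleton.1 hk
    rw [← iSup_ne_bot_subtype] at htop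
    rcases isEmpty_or_nonempty {χ | W χ ≠ ⊥} with hemp | ⟨⟨χ⟩⟩
    · refine ⟨0, top_le_iff.1 (htop ▸ ?_)⟩
      exact iSup_le fun χ => (hemp.false χ).elim
    · refine ⟨χ, top_le_iff.1 (htop ▸ iSup_le fun χ' => ?_)⟩
      exact (congrArg (fun ψ : {χ | W χ ≠ ⊥} => W ψ) (hsub.elim χ' χ)).le
  obtain ⟨χ, hχ⟩ := hex
  refine ⟨χ ⟨a, ha⟩, LinearMap.ext fun v => ?_⟩
  exact (hmemW χ v).1 (hχ ▸ Submodule.mem_top) ⟨a, ha⟩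

theorem IsPrimitiveLinearGroup.le_center [Finite G] (hG : IsPrimitiveLinearGroup G)
    (A : Subgroup G) (hA : A.Normal) (hA' : IsMulCommutative A) : A ≤ center G := by
  intro a ha
  obtain ⟨c, hc⟩ := hG.exists_eq_smul_one A a ha
  refine mem_center_iff.2 fun g => naturalRep_injective G ?_
  rw [map_mul, map_mul, hc]
  ext
  simp

theorem IsPrimitiveLinearGroup.pos (hG : IsPrimitiveLinearGroup G) : 0 < n := by
  rcases Nat.eq_zero_or_pos n with rfl | h
  · exfalso
    have := hG.irreducible
    obtain ⟨U, V, hUV⟩ := exists_pair_ne (Subrepresentation (naturalRep G))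
    refine hUV (SetLike.ext fun v => ?_)
    rw [Subsingleton.elim v 0]
    exact ⟨fun _ => V.toSubmodule.zero_mem, fun _ => U.toSubmodule.zero_mem⟩
  · exact h

theorem IsPrimitiveLinearGroup.isCyclic_center [Finite G] (hG : IsPrimitiveLinearGroup G) :
    IsCyclic (center G) := by
  have hsc : ∀ z : center G, ∃ c : ℂ, naturalRep G z = c • 1 := fun z =>
    hG.exists_eq_smul_one (center G) z z.2
  choose c hc using hsc
  have : Nonempty (Fin n) := ⟨⟨0, hG.pos⟩⟩
  have hinj : Function.Injective (fun c : ℂ => c • (1 : Module.End ℂ (Fin n → ℂ))) :=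
    fun a b h => by simpa using congrFun (LinearMap.congr_fun h 1) (Classical.arbitrary (Fin n))
  refine isCyclic_of_injective_ringHom (R := ℂ)
    { toFun := c
      map_one' := hinj ?_
      map_mul' := fun x y => hinj ?_ } fun x y h => ?_
  · simp [← hc]
  · simp only [← hc, coe_mul, map_mul, mul_smul]
    rw [hc x, hc y]; ext; simp [mul_left_comm]
  · refine Subtype.ext (naturalRep_injective G ?_)
    rw [hc, hc]
    exact congrArg (· • (1 : Module.End ℂ (Fin n → ℂ))) h

/-- If `y * x * y⁻¹ = z * x` with a central `z ≠ 1`, then `z` is a scalar different from `1`, so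
`x` has trace `0`. Hence the character of `M` vanishes off `Z(G)`. -/
theorem IsPrimitiveLinearGroup.card_dvd [Finite G] (hG : IsPrimitiveLinearGroup G)
    {M : Subgroup G} (hZM : center G ≤ M)
    (hM : ∀ x ∈ M, x ∉ center G → ∃ y ∈ M, ⁅y, x⁆ ≠ 1 ∧ ⁅y, x⁆ ∈ center G) :
    Nat.card M ∣ Nat.card (center G) * n ^ 2 := by
  have hsc : ∀ z ∈ center G, ∃ c : ℂ, naturalRep G z = c • 1 := fun z hz =>
    hG.exists_eq_smul_one (center G) z hz
  let ρ : Representation ℂ M (Fin n → ℂ) := (naturalRep G).comp M.subtype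
  have h := card_dvd_card_mul_finrank_sq ρ ((center G).subgroupOf M) (fun z hz => hsc z hz) ?_
  · rwa [Nat.card_congr (subgroupOfEquivOfLe hZM).toEquiv, Module.finrank_fin_fun] at h
  · intro x hx
    obtain ⟨y, hy, hyx, hyxZ⟩ := hM x x.2 hx
    obtain ⟨c, hc⟩ := hsc _ hyxZ
    have hc1 : c ≠ 1 := by
      rintro rfl
      refine hyx (naturalRep_injective G ?_)
      rw [hc, one_smul, map_one]
    let y' : M := ⟨y, hy⟩
    have h1 : ρ (y' * x * y'⁻¹) = c • ρ x := by
      have : y' * x * y'⁻¹ = ⁅y', x⁆ * x := by rw [commutatorElement_def]; group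
      rw [this, map_mul]
      change naturalRep G ⁅y, (x : G)⁆ * _ = _
      rw [hc, smul_mul_assoc, one_mul]
    have h2 := ρ.char_conj x y'
    rw [Representation.character, h1, map_smul, smul_eq_mul] at h2
    have h3 : (c - 1) * ρ.character x = 0 := by
      rw [sub_mul, one_mul, sub_eq_zero]; exact h2
    exact (mul_eq_zero.1 h3).resolve_left (sub_ne_zero.2 hc1)

end LinearGroups

/-! ### Automorphisms of groups of prime power order -/

section MulAutCount

theorem prod_Ico_sub_pos {q m k : ℕ} (hq : 2 ≤ q) : 0 < ∏ i ∈ Finset.Ico k m, (q ^ m - q ^ i) :=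
  Finset.prod_pos fun _ hi =>
    Nat.sub_pos_of_lt (Nat.pow_lt_pow_right hq (Finset.mem_Ico.1 hi).2)

/-- Automorphisms that agree on a subgroup `H` of order `q ^ k` are counted by the images of an
element outside `H`, and then by induction on the subgroup generated by `H` and that element. -/
theorem ncard_mulAut_eqOn_le {A : Type*} [Group A] [Finite A] {q m : ℕ} (hq : q.Prime)
    (hA : Nat.card A = q ^ m) (j : ℕ) :
    ∀ (k : ℕ) (H : Subgroup A) (S : Set (MulAut A)), m - k ≤ j → Nat.card H = q ^ k →
      (∀ γ ∈ S, ∀ δ ∈ S, ∀ x ∈ H, γ x = δ x) →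
      S.ncard ≤ ∏ i ∈ Finset.Ico k m, (q ^ m - q ^ i) := by
  classical
  have := Fintype.ofFinite A
  have := Fintype.ofFinite (MulAut A)
  have hkm : ∀ (k : ℕ) (H : Subgroup A), Nat.card H = q ^ k → k ≤ m := fun k H hH =>
    (Nat.pow_dvd_pow_iff_le_right hq.one_lt).1 (hH ▸ hA ▸ H.card_subgroup_dvd_card)
  have htriv : ∀ (k : ℕ) (H : Subgroup A) (S : Set (MulAut A)), H = ⊤ →
      (∀ γ ∈ S, ∀ δ ∈ S, ∀ x ∈ H, γ x = δ x) →
      S.ncard ≤ ∏ i ∈ Finset.Ico k m, (q ^ m - q ^ i) := by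
    rintro k H S rfl hS
    refine le_trans (Set.ncard_le_one_iff_subsingleton.2 fun γ hγ δ hδ => ?_)
      (prod_Ico_sub_pos hq.two_le)
    exact MulEquiv.ext fun x => hS γ hγ δ hδ x trivial
  induction j with
  | zero =>
    intro k H S hk hH hS
    refine htriv k H S (Subgroup.eq_top_of_le_card _ ?_) hS
    have := hkm k H hH
    rw [hA, hH, show k = m by omega]
  | succ j ih =>
    intro k H S hk hH hS
    by_cases htop : H = ⊤
    · exact htriv k H S htop hS
    rcases S.eq_empty_or_nonempty with rfl | ⟨γ₀, hγ₀⟩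
    · simp
    obtain ⟨x, -, hx⟩ := SetLike.exists_of_lt (lt_top_iff_ne_top.2 htop)
    have hlt : H < H ⊔ Subgroup.zpowers x :=
      lt_of_le_of_ne le_sup_left fun h => hx (h ▸ Subgroup.mem_sup_right
        (Subgroup.mem_zpowers x))
    obtain ⟨k', -, hk'⟩ := (Nat.dvd_prime_pow hq).1
      (hA ▸ (H ⊔ Subgroup.zpowers x).card_subgroup_dvd_card)
    have hkk' : k < k' := by
      by_contra h
      refine hlt.ne (Subgroup.eq_of_le_of_card_ge hlt.le ?_)
      rw [hH, hk']
      exact Nat.pow_le_pow_right hq.pos (not_lt.1 h)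
    have hk'm := hkm k' _ hk'
    have hfibre : ∀ a ∈ S.toFinset.image (fun γ : MulAut A => γ x),
        (S.toFinset.filter (fun γ : MulAut A => γ x = a)).card ≤
          ∏ i ∈ Finset.Ico (k + 1) m, (q ^ m - q ^ i) := by
      intro a _
      rw [← Set.ncard_coe_finset]
      refine (ih k' (H ⊔ Subgroup.zpowers x) _ (by omega) hk' ?_).trans ?_
      · intro γ hγ δ hδ y hy
        simp only [Finset.coe_filter, Set.mem_toFinset, Set.mem_ofPred_eq] at hγ hδ
        have hle : H ⊔ Subgroup.zpowers x ≤ MonoidHom.eqLocus (γ : A →* A) (δ : A →* A) :=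
          sup_le (fun z hz => hS γ hγ.1 δ hδ.1 z hz)
            (Subgroup.zpowers_le.2 (hγ.2.trans hδ.2.symm))
        exact hle hy
      · refine Finset.prod_le_prod_of_subset_of_one_le'
          (Finset.Ico_subset_Ico_left hkk') fun i hi _ => ?_
        exact Nat.sub_pos_of_lt (Nat.pow_lt_pow_right hq.one_lt (Finset.mem_Ico.1 hi).2)
    have h := Finset.card_le_mul_card_image (f := fun γ : MulAut A => γ x) S.toFinset _ hfibre
    have himage : (S.toFinset.image (fun γ : MulAut A => γ x)).card ≤ q ^ m - q ^ k := by
      rw [← Set.ncard_coe_finset]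
      have hsub : ((S.toFinset.image (fun γ : MulAut A => γ x) : Finset A) : Set A) ⊆
          Set.univ \ (γ₀ '' (H : Set A)) := by
        rintro _ hy
        obtain ⟨γ, hγ, rfl⟩ := Finset.mem_image.1 hy
        refine ⟨trivial, ?_⟩
        rintro ⟨z, hz, hzx⟩
        rw [hS γ₀ hγ₀ γ (Set.mem_toFinset.1 hγ) z hz] at hzx
        exact hx (γ.injective hzx ▸ hz)
      refine (Set.ncard_le_ncard hsub).trans (le_of_eq ?_)
      rw [Set.ncard_sdiff (Set.subset_univ _), Set.ncard_univ, hA,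
        Set.ncard_image_of_injective _ γ₀.injective, ← Nat.card_coe_set_eq]
      exact congrArg _ hH
    rw [Set.ncard_eq_toFinset_card', Finset.prod_eq_prod_Ico_succ_bot (by omega), mul_comm]
    exact h.trans (Nat.mul_le_mul_left _ himage)

/-- The order `∏ (q ^ m - q ^ i)` (over `i < m`) of `GL(m, q)`. -/
def generalLinearCard (q m : ℕ) : ℕ := ∏ i ∈ Finset.range m, (q ^ m - q ^ i)

/-- A group of order `q ^ m` has at most as many automorphisms as the elementary abelian one. -/
theorem card_mulAut_le {A : Type*} [Group A] [Finite A] {q m : ℕ} (hq : q.Prime)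
    (hA : Nat.card A = q ^ m) : Nat.card (MulAut A) ≤ generalLinearCard q m := by
  have h := ncard_mulAut_eqOn_le hq hA m 0 ⊥ Set.univ (by omega) (by simp)
    (fun γ _ δ _ x hx => by rw [Subgroup.mem_bot.1 hx, map_one, map_one])
  rwa [Set.ncard_univ, ← Finset.range_eq_Ico] at h

end MulAutCount

/-! ### Primitive permutation groups with a nilpotent normal subgroup -/

section PermutationGroups

open Subgroup MulAction

variable {G Ω : Type*} [Group G] [MulAction G Ω]

/-- An element centralizing a transitive subgroup is determined by its action on one point. -/
theorem eq_one_of_mem_centralizer_of_smul_eq [FaithfulSMul G Ω] (A : Subgroup G)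
    [IsPretransitive A Ω] {c : G} (hc : c ∈ centralizer (A : Set G)) {ω : Ω} (hω : c • ω = ω) :
    c = 1 := by
  refine FaithfulSMul.eq_of_smul_eq_smul (α := Ω) fun ω' => ?_
  obtain ⟨a, rfl⟩ := exists_smul_eq A ω ω'
  rw [one_smul, Subgroup.smul_def, smul_smul, ← mem_centralizer_iff.1 hc a a.2, mul_smul, hω]

variable [FaithfulSMul G Ω] [IsPreprimitive G Ω]

theorem isPretransitive_of_normal_ne_bot {A : Subgroup G} [A.Normal] (hA : A ≠ ⊥) :
    IsPretransitive A Ω := by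
  refine IsQuasiPreprimitive.isPretransitive_of_normal fun h => hA ?_
  refine (eq_bot_iff_forall _).2 fun a ha => FaithfulSMul.eq_of_smul_eq_smul (α := Ω) fun ω => ?_
  have hω : ω ∈ fixedPoints A Ω := h ▸ Set.mem_univ ω
  rw [one_smul]
  exact hω ⟨a, ha⟩

theorem centralizer_le_of_normal_isMulCommutative {A : Subgroup G} [A.Normal]
    [IsMulCommutative A] (hA : A ≠ ⊥) [Nonempty Ω] : centralizer (A : Set G) ≤ A := by
  intro c hc
  have := isPretransitive_of_normal_ne_bot (Ω := Ω) hA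
  obtain ⟨ω⟩ := ‹Nonempty Ω›
  obtain ⟨a, ha⟩ := exists_smul_eq A ω (c • ω)
  have h1 : (a : G)⁻¹ * c = 1 := by
    refine eq_one_of_mem_centralizer_of_smul_eq (Ω := Ω) A (mul_mem (inv_mem ?_) hc) (ω := ω) ?_
    · exact le_centralizer A a.2
    · rw [mul_smul, ← ha, Subgroup.smul_def, inv_smul_smul]
  rw [← inv_mul_eq_one.1 h1]
  exact a.2

theorem card_eq_of_normal_isMulCommutative {A : Subgroup G} [A.Normal]
    [IsMulCommutative A] (hA : A ≠ ⊥) [Nonempty Ω] : Nat.card A = Nat.card Ω := by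
  have := isPretransitive_of_normal_ne_bot (Ω := Ω) hA
  obtain ⟨ω⟩ := ‹Nonempty Ω›
  refine Nat.card_congr (Equiv.ofBijective (fun a : A => a • ω) ⟨fun a b hab => ?_,
    fun ω' => exists_smul_eq A ω ω'⟩)
  have h1 : ((b : G)⁻¹ * a) = 1 := by
    refine eq_one_of_mem_centralizer_of_smul_eq (Ω := Ω) A
      (le_centralizer A (mul_mem (inv_mem b.2) a.2)) (ω := ω) ?_
    have hab' : (a : G) • ω = (b : G) • ω := hab
    rw [mul_smul, hab', inv_smul_smul]
  exact Subtype.ext (inv_mul_eq_one.1 h1).symm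

/-- A nilpotent normal subgroup `N ≠ 1` contains the abelian normal subgroup `Z(N)`, which is its
own centralizer, so that `N = Z(N)`. -/
theorem isMulCommutative_of_normal_isNilpotent [Nonempty Ω] {N : Subgroup G} [N.Normal]
    (hN : Group.IsNilpotent N) (hN1 : N ≠ ⊥) : IsMulCommutative N := by
  have : Nontrivial N := (nontrivial_iff_ne_bot N).2 hN1
  have hZ : (center N).map N.subtype ≠ ⊥ := fun h =>
    Group.IsNilpotent.center_ne_bot (G := N) ((map_eq_bot_iff_of_injective _
      N.subtype_injective).1 h)
  have hle : N ≤ (center N).map N.subtype := by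
    refine le_trans ?_ (centralizer_le_of_normal_isMulCommutative (Ω := Ω) hZ)
    intro n hn
    rw [mem_centralizer_iff]
    rintro _ ⟨z, hz, rfl⟩
    exact (congrArg Subtype.val (mem_center_iff.1 hz ⟨n, hn⟩)).symm
  refine ⟨⟨fun a b => ?_⟩⟩
  obtain ⟨z, hz, hza⟩ := hle a.2
  obtain rfl : z = a := Subtype.ext hza
  exact (mem_center_iff.1 hz b).symm

theorem eq_of_normal_isMulCommutative [Finite G] [Nonempty Ω] {A B : Subgroup G} [A.Normal]
    [B.Normal] [IsMulCommutative A] [IsMulCommutative B] (hA : A ≠ ⊥) (hB : B ≠ ⊥) : A = B := by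
  have hcard : Nat.card A = Nat.card B := by
    rw [card_eq_of_normal_isMulCommutative (Ω := Ω) hA,
      card_eq_of_normal_isMulCommutative (Ω := Ω) hB]
  by_cases h : A ⊓ B = ⊥
  · have hBA : B ≤ A := by
      refine le_trans ?_ (centralizer_le_of_normal_isMulCommutative (Ω := Ω) hA)
      rw [← commutator_eq_bot_iff_le_centralizer]
      exact commutator_eq_bot_of_disjoint (disjoint_iff.2 h).symm
    exact (eq_of_le_of_card_ge hBA hcard.le).symm
  · have hAB : Nat.card (A ⊓ B : Subgroup G) = Nat.card A := by
      have : IsMulCommutative (A ⊓ B : Subgroup G) :=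
        ⟨⟨fun a b => by
          have hab := congrArg Subtype.val (mul_comm' (⟨a, a.2.1⟩ : A) (⟨b, b.2.1⟩ : A))
          exact Subtype.ext hab⟩⟩
      rw [card_eq_of_normal_isMulCommutative (Ω := Ω) h,
        card_eq_of_normal_isMulCommutative (Ω := Ω) hA]
    have h1 := eq_of_le_of_card_ge (inf_le_left : A ⊓ B ≤ A) hAB.ge
    exact eq_of_le_of_card_ge (h1 ▸ inf_le_right) hcard.ge

theorem fittingSubgroup_of_isPreprimitive [Finite G] (hF : fittingSubgroup G ≠ ⊥) :
    (fittingSubgroup G).Normal ∧ IsMulCommutative (fittingSubgroup G) ∧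
      (∀ A : Subgroup G, A.Normal → IsMulCommutative A → A ≤ fittingSubgroup G) ∧
      Nat.card (fittingSubgroup G) = Nat.card Ω ∧
      (fittingSubgroup G).index ≤ Nat.card (MulAut (fittingSubgroup G)) := by
  have hle : ∀ A : Subgroup G, A.Normal → IsMulCommutative A → A ≤ fittingSubgroup G :=
    fun A hA hA' => by
      let _ : CommGroup A := { (inferInstance : Group A) with mul_comm := mul_comm' }
      exact le_sSup ⟨hA, CommGroup.isNilpotent⟩
  obtain ⟨N, ⟨hNn, hN⟩, hN1⟩ : ∃ N ∈ {N : Subgroup G | N.Normal ∧ Group.IsNilpotent N}, N ≠ ⊥ := by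
    by_contra! h
    exact hF (sSup_eq_bot.2 h)
  have hΩ : Nonempty Ω := by
    by_contra hΩ
    rw [not_nonempty_iff] at hΩ
    refine hN1 ((eq_bot_iff_forall _).2 fun a _ => ?_)
    exact FaithfulSMul.eq_of_smul_eq_smul (α := Ω) fun ω => (hΩ.false ω).elim
  have hNc := isMulCommutative_of_normal_isNilpotent (Ω := Ω) hN hN1
  have hFN : fittingSubgroup G = N := by
    refine le_antisymm (sSup_le ?_) (hle N hNn hNc)
    rintro L ⟨hLn, hL⟩
    by_cases hL1 : L = ⊥
    · rw [hL1]; exact bot_le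
    · have := isMulCommutative_of_normal_isNilpotent (Ω := Ω) hL hL1
      exact (eq_of_normal_isMulCommutative (Ω := Ω) hL1 hN1).le
  refine ⟨hFN ▸ hNn, hFN ▸ hNc, hle, ?_, ?_⟩
  · rw [hFN]; exact card_eq_of_normal_isMulCommutative hN1
  · rw [hFN]
    have hker : (MulAut.conjNormal : G →* MulAut N).ker = N := by
      refine le_antisymm (le_trans ?_
        (centralizer_le_of_normal_isMulCommutative (Ω := Ω) hN1)) fun g hg => ?_
      · intro g hg
        rw [mem_centralizer_iff]
        intro x hx
        have h1 := MulAut.conjNormal_apply g (⟨x, hx⟩ : N)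
        rw [MonoidHom.mem_ker.1 hg] at h1
        exact eq_mul_inv_iff_mul_eq.1 h1
      · rw [MonoidHom.mem_ker]
        refine MulEquiv.ext fun x => Subtype.ext ?_
        have h1 : g * x = x * g := congrArg Subtype.val (mul_comm' (⟨g, hg⟩ : N) x)
        rw [MulAut.conjNormal_apply, h1, mul_inv_cancel_right]
        rfl
    conv_lhs => rw [← hker]
    rw [index_ker]
    exact Nat.card_le_card_of_injective _ Subtype.val_injective

end PermutationGroups

/-! ### Numerical estimates -/

section Estimates

theorem mul_pow_le_pow_of_le {a k c y₀ : ℕ} (hy₀ : 0 < y₀) (hbase : a * y₀ ^ k ≤ c ^ y₀)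
    (hstep : (y₀ + 1) ^ k ≤ c * y₀ ^ k) (y : ℕ) (hy : y₀ ≤ y) : a * y ^ k ≤ c ^ y := by
  induction y, hy using Nat.le_induction with
  | base => exact hbase
  | succ y hy ih =>
    have h1 : (y + 1) ^ k ≤ c * y ^ k := by
      refine le_of_mul_le_mul_left (a := y₀ ^ k) ?_ (pow_pos hy₀ k)
      calc y₀ ^ k * (y + 1) ^ k = (y₀ * (y + 1)) ^ k := (mul_pow _ _ _).symm
        _ ≤ ((y₀ + 1) * y) ^ k := Nat.pow_le_pow_left (by nlinarith) k
        _ = (y₀ + 1) ^ k * y ^ k := mul_pow _ _ _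
        _ ≤ c * y₀ ^ k * y ^ k := Nat.mul_le_mul_right _ hstep
        _ = y₀ ^ k * (c * y ^ k) := by ring
    calc a * (y + 1) ^ k ≤ a * (c * y ^ k) := Nat.mul_le_mul_left _ h1
      _ = c * (a * y ^ k) := by ring
      _ ≤ c * c ^ y := Nat.mul_le_mul_left _ ih
      _ = c ^ (y + 1) := by ring

/-- Induction on `m` for bounds of the form `a m ^ e ≤ c ^ (q ^ m - 1)`; note that
`q ^ (m + 1) - 1 = (q ^ m - 1) + q ^ m * (q - 1)`. -/
theorem pow_le_pow_of_ratio_le {q e c m₀ : ℕ} (hq : 2 ≤ q) (a r : ℕ → ℕ)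
    (hrec : ∀ m, a (m + 1) = a m * r m) (hbase : ∀ m ≤ m₀, a m ^ e ≤ c ^ (q ^ m - 1))
    (hstep : ∀ m, m₀ ≤ m → r m ^ e ≤ c ^ (q ^ m * (q - 1))) (m : ℕ) :
    a m ^ e ≤ c ^ (q ^ m - 1) := by
  rcases le_total m m₀ with h | h
  · exact hbase m h
  induction m, h using Nat.le_induction with
  | base => exact hbase m₀ le_rfl
  | succ m hm ih =>
    have hexp : q ^ (m + 1) - 1 = (q ^ m - 1) + q ^ m * (q - 1) := by
      obtain ⟨p, rfl⟩ : ∃ p, q = p + 1 := ⟨q - 1, by omega⟩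
      have : 0 < (p + 1) ^ m := by positivity
      rw [pow_succ, Nat.add_sub_cancel, mul_add, mul_one]
      omega
    rw [hrec, mul_pow, hexp, pow_add]
    exact Nat.mul_le_mul ih (hstep m hm)

theorem generalLinearCard_succ (q m : ℕ) :
    generalLinearCard q (m + 1) = generalLinearCard q m * (q ^ m * (q * q ^ m - 1)) := by
  have h : ∀ i, q ^ (m + 1) - q ^ (i + 1) = q * (q ^ m - q ^ i) := fun i => by
    rw [Nat.mul_sub, pow_succ', pow_succ']
  rw [generalLinearCard, Finset.prod_range_succ', Finset.prod_congr rfl fun i _ => h i,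
    Finset.prod_mul_distrib, Finset.prod_const, Finset.card_range, pow_zero, pow_succ' q m,
    generalLinearCard]
  ring

theorem symplecticCard_succ' (q m : ℕ) :
    symplecticCard q (m + 1) =
      symplecticCard q m * (((q * q ^ m) ^ 2 - 1) * (q * q ^ m * q ^ m)) := by
  have h1 : (q * q ^ m) ^ 2 = q ^ (2 * (m + 1)) := by ring
  have h2 : q * q ^ m * q ^ m = q ^ (2 * m + 1) := by ring
  rw [symplecticCard_succ, h1, h2]

/-- The estimates are made in terms of `y = q ^ m * (q - 1)`; here `q ≤ 2 (q - 1)` is used. -/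
theorem le_mul_sub_one {q : ℕ} (hq : 2 ≤ q) (m : ℕ) :
    q ^ m ≤ q ^ m * (q - 1) ∧ q * q ^ m ≤ 2 * (q ^ m * (q - 1)) := by
  obtain ⟨p, rfl⟩ : ∃ p, q = p + 2 := ⟨q - 2, by omega⟩
  have h : p + 2 - 1 = p + 1 := rfl
  rw [h]
  generalize (p + 2) ^ m = x
  constructor <;> nlinarith

theorem six_le_mul_sub_one {q m : ℕ} (hq : 3 ≤ q) (hm : 1 ≤ m) : 6 ≤ q ^ m * (q - 1) := by
  have h1 : 3 ≤ q ^ m := hq.trans (Nat.le_self_pow (by omega) q)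
  have h2 : 2 ≤ q - 1 := by omega
  calc 6 = 3 * 2 := rfl
    _ ≤ _ := Nat.mul_le_mul h1 h2

theorem four_le_mul_sub_one {q m : ℕ} (hq : 2 ≤ q) (hm : 2 ≤ m) : 4 ≤ q ^ m * (q - 1) := by
  have h1 : 2 ^ 2 ≤ q ^ m := (Nat.pow_le_pow_left hq 2).trans (Nat.pow_le_pow_right (by omega) hm)
  exact h1.trans (le_mul_sub_one hq m).1

theorem generalLinearCard_pow_seven_le {q : ℕ} (hq : 2 ≤ q) (m : ℕ) :
    generalLinearCard q m ^ 7 ≤ 168 ^ (q ^ m - 1) := by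
  have hstep : ∀ m, 6 ≤ q ^ m * (q - 1) →
      (q ^ m * (q * q ^ m - 1)) ^ 7 ≤ 168 ^ (q ^ m * (q - 1)) := by
    intro m hm
    obtain ⟨h1, h2⟩ := le_mul_sub_one hq m
    generalize q ^ m * (q - 1) = y at *
    refine le_trans ?_ (mul_pow_le_pow_of_le (a := 128) (k := 14) (y₀ := 6) (by norm_num)
      (by norm_num) (by norm_num) y hm)
    calc (q ^ m * (q * q ^ m - 1)) ^ 7 ≤ (y * (2 * y)) ^ 7 :=
          Nat.pow_le_pow_left (Nat.mul_le_mul h1 ((Nat.sub_le _ _).trans h2)) 7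
      _ = 128 * y ^ 14 := by ring
  rcases hq.eq_or_lt with rfl | hq3
  · refine pow_le_pow_of_ratio_le (m₀ := 3) le_rfl _ _ (generalLinearCard_succ 2) ?_ ?_ m
    · intro m hm
      interval_cases m <;> simp [generalLinearCard, Finset.prod_range_succ]
    · intro m hm
      refine hstep m ?_
      have : 2 ^ 3 ≤ 2 ^ m := Nat.pow_le_pow_right (by norm_num) hm
      omega
  · refine pow_le_pow_of_ratio_le (m₀ := 0) hq _ _ (generalLinearCard_succ q) ?_ ?_ m
    · intro m hm
      interval_cases m; simp [generalLinearCard]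
    · intro m _
      rcases Nat.eq_zero_or_pos m with rfl | hm
      · have h := mul_pow_le_pow_of_le (a := 1) (k := 7) (c := 168) (y₀ := 1) (by norm_num)
          (by norm_num) (by norm_num) (q - 1) (by omega)
        simpa using h
      · exact hstep m (six_le_mul_sub_one hq3 hm)

theorem pow_mul_generalLinearCard_pow_three_le {q : ℕ} (hq : 2 ≤ q) (m : ℕ) :
    (q ^ m * generalLinearCard q m) ^ 3 ≤ 24 ^ (q ^ m - 1) := by
  have hrec : ∀ m, q ^ (m + 1) * generalLinearCard q (m + 1) =
      (q ^ m * generalLinearCard q m) * ((q * q ^ m) * (q * q ^ m - 1)) := fun m => by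
    rw [generalLinearCard_succ, pow_succ']; ring
  have hstep : ∀ m, 4 ≤ q ^ m * (q - 1) →
      ((q * q ^ m) * (q * q ^ m - 1)) ^ 3 ≤ 24 ^ (q ^ m * (q - 1)) := by
    intro m hm
    obtain ⟨-, h2⟩ := le_mul_sub_one hq m
    generalize q ^ m * (q - 1) = y at *
    refine le_trans ?_ (mul_pow_le_pow_of_le (a := 64) (k := 6) (y₀ := 4) (by norm_num)
      (by norm_num) (by norm_num) y hm)
    calc ((q * q ^ m) * (q * q ^ m - 1)) ^ 3 ≤ ((2 * y) * (2 * y)) ^ 3 :=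
          Nat.pow_le_pow_left (Nat.mul_le_mul h2 ((Nat.sub_le _ _).trans h2)) 3
      _ = 64 * y ^ 6 := by ring
  rcases hq.eq_or_lt with rfl | hq3
  · refine pow_le_pow_of_ratio_le (m₀ := 2) le_rfl
      (fun m => 2 ^ m * generalLinearCard 2 m) _ hrec ?_ ?_ m
    · intro m hm
      interval_cases m <;> simp [generalLinearCard, Finset.prod_range_succ]
    · exact fun m hm => hstep m (four_le_mul_sub_one le_rfl hm)
  · refine pow_le_pow_of_ratio_le (m₀ := 0) hq
      (fun m => q ^ m * generalLinearCard q m) _ hrec ?_ ?_ m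
    · intro m hm
      interval_cases m; simp [generalLinearCard]
    · intro m _
      rcases Nat.eq_zero_or_pos m with rfl | hm
      · obtain ⟨y, rfl⟩ : ∃ y, q = y + 1 := ⟨q - 1, by omega⟩
        have h := mul_pow_le_pow_of_le (a := 8) (k := 6) (c := 24) (y₀ := 2) (by norm_num)
          (by norm_num) (by norm_num) y (by omega)
        have h1 : (y + 1) * y ≤ 2 * y ^ 2 := by nlinarith
        simp only [pow_zero, mul_one, one_mul, Nat.add_sub_cancel]
        calc ((y + 1) * y) ^ 3 ≤ (2 * y ^ 2) ^ 3 := Nat.pow_le_pow_left h1 3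
          _ = 8 * y ^ 6 := by ring
          _ ≤ _ := h
      · exact hstep m ((by norm_num : 4 ≤ 6).trans (six_le_mul_sub_one hq3 hm))

theorem symplectic_ratio_le {q : ℕ} (hq : 2 ≤ q) (m : ℕ) :
    ((q * q ^ m) ^ 2 - 1) * (q * q ^ m * q ^ m) ≤ 8 * (q ^ m * (q - 1)) ^ 4 := by
  obtain ⟨h1, h2⟩ := le_mul_sub_one hq m
  generalize q ^ m * (q - 1) = y at *
  calc ((q * q ^ m) ^ 2 - 1) * (q * q ^ m * q ^ m) ≤ (2 * y) ^ 2 * (2 * y * y) :=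
        Nat.mul_le_mul ((Nat.sub_le _ _).trans (Nat.pow_le_pow_left h2 2)) (Nat.mul_le_mul h2 h1)
    _ = 8 * y ^ 4 := by ring

theorem symplecticCard_pow_three_le {q : ℕ} (hq : 2 ≤ q) (m : ℕ) :
    symplecticCard q m ^ 3 ≤ 720 ^ (q ^ m - 1) := by
  have hstep : ∀ m, 4 ≤ q ^ m * (q - 1) →
      (((q * q ^ m) ^ 2 - 1) * (q * q ^ m * q ^ m)) ^ 3 ≤ 720 ^ (q ^ m * (q - 1)) := by
    intro m hm
    refine le_trans ?_ (mul_pow_le_pow_of_le (a := 512) (k := 12) (y₀ := 4) (by norm_num)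
      (by norm_num) (by norm_num) _ hm)
    exact (Nat.pow_le_pow_left (symplectic_ratio_le hq m) 3).trans (le_of_eq (by ring))
  rcases hq.eq_or_lt with rfl | hq3
  · refine pow_le_pow_of_ratio_le (m₀ := 2) le_rfl _ _ (symplecticCard_succ' 2) ?_ ?_ m
    · intro m hm
      interval_cases m <;> simp [symplecticCard, Finset.prod_range_succ]
    · exact fun m hm => hstep m (four_le_mul_sub_one le_rfl hm)
  · refine pow_le_pow_of_ratio_le (m₀ := 0) hq _ _ (symplecticCard_succ' q) ?_ ?_ m
    · intro m hm
      interval_cases m; simp [symplecticCard]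
    · intro m _
      rcases Nat.eq_zero_or_pos m with rfl | hm
      · obtain ⟨y, rfl⟩ : ∃ y, q = y + 1 := ⟨q - 1, by omega⟩
        have h := mul_pow_le_pow_of_le (a := 27) (k := 9) (c := 720) (y₀ := 2) (by norm_num)
          (by norm_num) (by norm_num) y (by omega)
        have h1 : ((y + 1) ^ 2 - 1) * (y + 1) ≤ 3 * y ^ 3 := by
          have h2 : (y + 1) ^ 2 - 1 = y * (y + 2) := by
            rw [Nat.sub_eq_iff_eq_add (by nlinarith)]; ring
          have h3 : (y + 2) * (y + 1) ≤ 3 * y ^ 2 := by nlinarith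
          rw [h2]
          nlinarith
        simp only [pow_zero, mul_one, one_mul, Nat.add_sub_cancel]
        calc (((y + 1) ^ 2 - 1) * (y + 1)) ^ 3 ≤ (3 * y ^ 3) ^ 3 := Nat.pow_le_pow_left h1 3
          _ = 27 * y ^ 9 := by ring
          _ ≤ _ := h
      · exact hstep m ((by norm_num : 4 ≤ 6).trans (six_le_mul_sub_one hq3 hm))

theorem pow_mul_symplecticCard_le {q : ℕ} (hq : 2 ≤ q) (m : ℕ) :
    q ^ (2 * m) * symplecticCard q m ≤ 24 ^ (q ^ m - 1) := by
  have hrec : ∀ m, q ^ (2 * (m + 1)) * symplecticCard q (m + 1) =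
      (q ^ (2 * m) * symplecticCard q m) *
        (q ^ 2 * (((q * q ^ m) ^ 2 - 1) * (q * q ^ m * q ^ m))) := fun m => by
    rw [symplecticCard_succ', show 2 * (m + 1) = 2 * m + 2 by ring, pow_add]; ring
  have hstep : ∀ m, 4 ≤ q ^ m * (q - 1) →
      (q ^ 2 * (((q * q ^ m) ^ 2 - 1) * (q * q ^ m * q ^ m))) ^ 1 ≤ 24 ^ (q ^ m * (q - 1)) := by
    intro m hm
    have hq2 : q ≤ 2 * (q ^ m * (q - 1)) :=
      (Nat.le_mul_of_pos_right q (pow_pos (by omega) m)).trans (le_mul_sub_one hq m).2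
    have hr := symplectic_ratio_le hq m
    refine le_trans ?_ (mul_pow_le_pow_of_le (a := 32) (k := 6) (y₀ := 4) (by norm_num)
      (by norm_num) (by norm_num) _ hm)
    rw [pow_one]
    exact (Nat.mul_le_mul (Nat.pow_le_pow_left hq2 2) hr).trans (le_of_eq (by ring))
  refine (pow_one _).symm.le.trans ?_
  rcases hq.eq_or_lt with rfl | hq3
  · refine pow_le_pow_of_ratio_le (m₀ := 2) le_rfl
      (fun m => 2 ^ (2 * m) * symplecticCard 2 m) _ hrec ?_ ?_ m
    · intro m hm
      interval_cases m <;> simp [symplecticCard, Finset.prod_range_succ]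
    · exact fun m hm => hstep m (four_le_mul_sub_one le_rfl hm)
  · refine pow_le_pow_of_ratio_le (m₀ := 0) hq
      (fun m => q ^ (2 * m) * symplecticCard q m) _ hrec ?_ ?_ m
    · intro m hm
      interval_cases m; simp [symplecticCard]
    · intro m _
      rcases Nat.eq_zero_or_pos m with rfl | hm
      · obtain ⟨y, rfl⟩ : ∃ y, q = y + 1 := ⟨q - 1, by omega⟩
        have h := mul_pow_le_pow_of_le (a := 12) (k := 5) (c := 24) (y₀ := 2) (by norm_num)
          (by norm_num) (by norm_num) y (by omega)
        have h1 : ((y + 1) ^ 2 - 1) * (y + 1) ≤ 3 * y ^ 3 := by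
          have h2 : (y + 1) ^ 2 - 1 = y * (y + 2) := by
            rw [Nat.sub_eq_iff_eq_add (by nlinarith)]; ring
          have h3 : (y + 2) * (y + 1) ≤ 3 * y ^ 2 := by nlinarith
          rw [h2]
          nlinarith
        have h4 : (y + 1) ^ 2 ≤ 4 * y ^ 2 := by nlinarith
        simp only [pow_zero, mul_one, one_mul, Nat.add_sub_cancel, pow_one]
        calc (y + 1) ^ 2 * (((y + 1) ^ 2 - 1) * (y + 1)) ≤ (4 * y ^ 2) * (3 * y ^ 3) :=
              Nat.mul_le_mul h4 h1
          _ = 12 * y ^ 5 := by ring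
          _ ≤ _ := h
      · exact hstep m ((by norm_num : 4 ≤ 6).trans (six_le_mul_sub_one hq3 hm))

theorem cast_le_rpow_div {a c e k : ℕ} (he : e ≠ 0) (h : a ^ e ≤ c ^ k) :
    (a : ℝ) ≤ (c : ℝ) ^ ((k : ℝ) / e) := by
  rw [← pow_le_pow_iff_left₀ (Nat.cast_nonneg a) (Real.rpow_nonneg (Nat.cast_nonneg c) _) he,
    ← Real.rpow_natCast ((c : ℝ) ^ _), ← Real.rpow_mul (Nat.cast_nonneg c),
    div_mul_cancel₀ _ (Nat.cast_ne_zero.2 he), Real.rpow_natCast]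
  exact_mod_cast h

theorem rpow_div_three_lt {a b x : ℝ} (ha : 0 < a) (hb : 0 < b) (hab : a < b ^ 3) (hx : 0 < x) :
    a ^ (x / 3) < b ^ x := by
  have h : b ^ x = (b ^ 3) ^ (x / 3) := by
    rw [← Real.rpow_natCast, ← Real.rpow_mul hb.le]
    congr 1
    push_cast
    ring
  rw [h]
  exact Real.rpow_lt_rpow ha.le hab (by positivity)

end Estimates

/-! ### The bounds for primitive groups -/

theorem corollary4p2 :
    -- part (a): primitive permutation groups
    (∀ (Ω : Type*) [Finite Ω] (G : Subgroup (Equiv.Perm Ω)) (d q m : ℕ),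
      MulAction.IsPreprimitive G Ω → Nat.card Ω = d → q.Prime → d = q ^ m →
      fittingSubgroup G ≠ ⊥ →
        IsGreatest {A : Subgroup G | A.Normal ∧ IsMulCommutative A} (fittingSubgroup G) ∧
        (Nat.card G : ℝ) ≤ (24 : ℝ) ^ (((d : ℝ) - 1) / 3) ∧
        (24 : ℝ) ^ (((d : ℝ) - 1) / 3) < (3 : ℝ) ^ ((d : ℝ) - 1) ∧
        ((fittingSubgroup G).index : ℝ) ≤ (168 : ℝ) ^ (((d : ℝ) - 1) / 7)) ∧
    -- part (b): primitive linear groups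
    (∀ (n : ℕ) (G : Subgroup (Matrix.GeneralLinearGroup (Fin n) ℂ)) [Finite G],
      IsPrimitiveLinearGroup G → fittingSubgroup G ≠ Subgroup.center G →
      ∀ M : Subgroup G,
        Minimal (fun N : Subgroup G =>
          N.Normal ∧ Subgroup.center G < N ∧ N ≤ fittingSubgroup G) M →
        ∃ q m : ℕ, q.Prime ∧ 0 < m ∧ q ^ m ∣ n ∧
          (∃ Q : Subgroup G, IsExtraspecial q Q ∧ Nat.card Q = q ^ (2 * m + 1) ∧
            M = Subgroup.center G ⊔ Q) ∧
          ((M ⊔ Subgroup.centralizer (M : Set G)).index : ℝ) ≤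
            (720 : ℝ) ^ (((q : ℝ) ^ m - 1) / 3) ∧
          (720 : ℝ) ^ (((q : ℝ) ^ m - 1) / 3) < (9 : ℝ) ^ ((q : ℝ) ^ m - 1) ∧
          ((Subgroup.centralizer (M : Set G)).index : ℝ) ≤ (24 : ℝ) ^ ((q : ℝ) ^ m - 1)) := by

  refine ⟨?_, ?_⟩
  · intro Ω _ G d q m hprim hcard hq hd hF
    obtain ⟨hFn, hFc, hle, hFcard, hidx⟩ := fittingSubgroup_of_isPreprimitive (Ω := Ω) hF
    rw [hcard] at hFcard
    have hAut := card_mulAut_le hq (hFcard.trans hd)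
    have hd0 : 0 < d := hFcard ▸ Nat.card_pos
    have hd1 : ((d - 1 : ℕ) : ℝ) = (d : ℝ) - 1 := by rw [Nat.cast_sub hd0, Nat.cast_one]
    have hd2 : 1 < d := hFcard ▸ (Subgroup.one_lt_card_iff_ne_bot _).2 hF
    have hd3 : (0 : ℝ) < (d : ℝ) - 1 := sub_pos.2 (by exact_mod_cast hd2)
    refine ⟨⟨⟨hFn, hFc⟩, fun A hA => hle A hA.1 hA.2⟩, ?_,
      rpow_div_three_lt (by norm_num) (by norm_num) (by norm_num) hd3, ?_⟩
    · have h : Nat.card G ^ 3 ≤ 24 ^ (d - 1) := by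
        refine le_trans (Nat.pow_le_pow_left ?_ 3)
          (hd ▸ pow_mul_generalLinearCard_pow_three_le hq.two_le m)
        rw [← (fittingSubgroup G).card_mul_index, hFcard, hd]
        exact Nat.mul_le_mul_left _ (hidx.trans hAut)
      simpa [hd1] using cast_le_rpow_div (by norm_num) h
    · have h : (fittingSubgroup G).index ^ 7 ≤ 168 ^ (d - 1) :=
        (Nat.pow_le_pow_left (hidx.trans hAut) 7).trans
          (hd ▸ generalLinearCard_pow_seven_le hq.two_le m)
      simpa [hd1] using cast_le_rpow_div (by norm_num) h
  · intro n G _ hG _ M hM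
    obtain ⟨⟨hMn, hZM, hMF⟩, hmin⟩ := hM
    have hcyc := hG.isCyclic_center
    obtain ⟨q, m, hq, hm, hoff, hcardM, hQ, hidx, hidxC⟩ :=
      exists_prime_of_minimal_normal hG.le_center hZM
        (fun L hL hZL hLM => le_antisymm hLM (hmin ⟨hL, hZL, hLM.trans hMF⟩ hLM)) hMF
    have hdvd : q ^ m ∣ n := by
      have h := hG.card_dvd hZM.le hoff
      rw [hcardM] at h
      have h2 := Nat.dvd_of_mul_dvd_mul_left Nat.card_pos h
      rw [mul_comm 2, pow_mul] at h2
      exact (Nat.pow_dvd_pow_iff two_ne_zero).1 h2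
    have hqm : 1 < q ^ m := Nat.one_lt_pow hm.ne' hq.one_lt
    have hqm1 : ((q ^ m - 1 : ℕ) : ℝ) = (q : ℝ) ^ m - 1 := by
      rw [Nat.cast_sub hqm.le, Nat.cast_pow, Nat.cast_one]
    have hqm2 : (0 : ℝ) < (q : ℝ) ^ m - 1 := sub_pos.2 (by exact_mod_cast hqm)
    refine ⟨q, m, hq, hm, hdvd, hQ, ?_,
      rpow_div_three_lt (by norm_num) (by norm_num) (by norm_num) hqm2, ?_⟩
    · have h := (Nat.pow_le_pow_left hidx 3).trans (symplecticCard_pow_three_le hq.two_le m)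
      simpa [hqm1] using cast_le_rpow_div (by norm_num) h
    · have h := hidxC.trans (pow_mul_symplecticCard_le hq.two_le m)
      rw [← hqm1, Real.rpow_natCast]
      exact_mod_cast h
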